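/- Let $\mathbb T=\mathbb R/\mathbb Z$, let $\mathcal S(\mathbb T)$ be the space of smooth $1$-periodic functions, $\mathcal S'(\mathbb T)$ the space of periodic generalized functions, $e_k(t)=e^{2\pi i k t}$, and $\widehat f[k]=\langle f,e_k\rangle$ the Fourier coefficients. Let $\mathrm L$ be a continuous, linear, shift-invariant, real operator from $\mathcal S(\mathbb T)$ to $\mathcal S'(\mathbb T)$ with frequency response $\widehat L[k]$, $\mathrm L e_k=\widehat L[k]e_k$, whose null space $\mathcal N_{\mathrm L}$ (for its extension to $\mathcal S'(\mathbb T)$) is finite-dimensional, and let $\gamma_0>0$, $\sigma_0>0$. Put $\mathrm L_{\gamma_0}=\mathrm L+\gamma_0\,\mathrm{Proj}_{\mathcal N_{\mathrm L}}$ and let $\mathcal H_{\mathrm L}=\{f\in\mathcal S'(\mathbb T):\mathrm Lf\in L_2(\mathbb T)\}$ with the norm $\|f\|_{\mathcal H_{\mathrm L}}=\|\mathrm L_{\gamma_0}f\|_{L_2}$. Assume that $\mathcal H_{\mathrm L}$ is a reproducing-kernel Hilbert space, i.e. that all shifted Dirac combs belong to $\mathcal H_{\mathrm L}'$, and let $$h_{\gamma_0}(t)=\sum_{k:\,\widehat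 L[k]=0}\frac{e_k(t)}{\gamma_0^2}+\sum_{k:\,\widehat L[k]\ne0}\frac{e_k(t)}{|\widehat L[k]|^2},$$ so that $h_{\gamma_0}(t-\tau)$ is its reproducing kernel. Let $s$ be a Gaussian bridge $s\sim\mathcal{GB}(\mathrm L,\gamma_0^2)$, i.e. a solution of $\mathrm L_{\gamma_0}s=w$ with $w$ a (real, centered) periodic Gaussian white noise: $\mathbb E[\langle w,f\rangle\langle w,g\rangle]=\int_0^1fg$ for real $f,g\in\mathcal S(\mathbb T)$. Let $\nu_1,\dots,\nu_M\in\mathcal H_{\mathrm L}'$ be real measurement functions, and let $y_m=\langle\nu_m,s\rangle+\epsilon_m$, $m=1,\dots,M$, where $\langle\nu_m,s\rangle=\sum_k\widehat s[k]\,\overline{\widehat\nu_m[k]}$ (a symmetric series converging in mean square) and $\epsilon_1,\dots,\epsilon_M$ are i.i.d. $\mathcal N(0,\sigma_0^2)$ and independent of $s$. Let $\varphi_m=h_{\gamma_0}*\nu_m$, i.e. $\varphi_m(t)=\langle\nu_m,h_{\gamma_0}(t-\cdot)\rangle$, and let $\mathbf G$ be the Gram matrix $[\mathbf G]_{m,n}=\langle\nu_m,h_{\gamma_0}*\nu_n\rangle=\int_0^1\!\int_0^1\nu_m(t)h_{\gamma_0}(t-\tau)\nu_n(\tau)\,\mathrm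 dt\,\mathrm d\tau$. Then the $\varphi_m$ and $\mathbf G$ are well defined and real, $\mathbf G+\sigma_0^2\mathbf I$ is invertible, and $$\tilde s_{\mathrm{MMSE}}(t)=\sum_{m=1}^M d_m\varphi_m(t),\qquad \mathbf d=(\mathbf G+\sigma_0^2\mathbf I)^{-1}\mathbf y,$$ is the minimum mean-square error estimator of the whole process $s$ given $\mathbf y$: it has finite error and it minimizes $\mathbb E[\|s-\tilde s\|_{L_2}^2]$ among all estimators $\tilde s=F(\mathbf y)$ with $F:\mathbb R^M\to L_2(\mathbb T)$ measurable, and every minimizer coincides with it almost surely. -/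

import Mathlib

open MeasureTheory ProbabilityTheory Filter Topology
open scoped ENNReal NNReal

noncomputable section

namespace PeriodicMMSE

/-! ### Smooth periodic functions and periodic generalized functions

The circle is `UnitAddCircle = ℝ ⧸ ℤ` and carries its Haar probability measure. The complex
sinusoid `e_k(t) = exp (2 π i k t)` is `fourier k`, and `fourierCoeff f k = ∫ f(t) e_{-k}(t) dt`. -/

/-- The normalized Lebesgue measure of the circle. -/
abbrev haar : Measure UnitAddCircle := AddCircle.haarAddCircle

/-- The Hilbert space of square-integrable `1`-periodic functions. -/
abbrev L2 : Type := Lp ℂ 2 haar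

/-- The space of smooth `1`-periodic functions. -/
def PerTest : Submodule ℂ (UnitAddCircle → ℂ) where
  carrier := {φ | ContDiff ℝ (⊤ : ℕ∞) (fun x : ℝ => φ (x : UnitAddCircle))}
  add_mem' := by
    intro f g hf hg
    exact ContDiff.add (Set.mem_ofPred.1 hf) (Set.mem_ofPred.1 hg)
  zero_mem' := by
    have h : ContDiff ℝ (⊤ : ℕ∞) (fun _ : ℝ => (0 : ℂ)) := contDiff_const
    exact h
  smul_mem' := by
    intro c f hf
    exact ContDiff.const_smul c (Set.mem_ofPred.1 hf)

/-- Continuity of a linear functional for the Fréchet topology given by the seminorms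
`φ ↦ sup |φ^(j)|`: it is bounded by a multiple of the maximum of finitely many of them. -/
def IsContinuousFunctional (u : PerTest →ₗ[ℂ] ℂ) : Prop :=
  ∃ (N : ℕ) (C : ℝ), ∀ (φ : PerTest) (B : ℝ),
    (∀ j ≤ N, ∀ x : ℝ, ‖iteratedDeriv j (fun x : ℝ => φ.1 (x : UnitAddCircle)) x‖ ≤ B) →
      ‖u φ‖ ≤ C * B

/-- The space of periodic generalized functions, the dual of `PerTest`. The (bilinear) duality
bracket of `u` and `φ` is `u.1 φ`. -/
def PerDist : Submodule ℂ (PerTest →ₗ[ℂ] ℂ) where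
  carrier := {u | IsContinuousFunctional u}
  add_mem' := by
    rintro u v ⟨N, C, hu⟩ ⟨N', C', hv⟩
    refine ⟨max N N', C + C', fun φ B hB => ?_⟩
    have h1 := hu φ B fun j hj => hB j (hj.trans (le_max_left _ _))
    have h2 := hv φ B fun j hj => hB j (hj.trans (le_max_right _ _))
    calc ‖(u + v) φ‖ ≤ ‖u φ‖ + ‖v φ‖ := norm_add_le _ _
      _ ≤ (C + C') * B := by linarith
  zero_mem' := ⟨0, 0, fun φ B _ => by simp⟩
  smul_mem' := by
    rintro c u ⟨N, C, hu⟩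
    refine ⟨N, ‖c‖ * C, fun φ B hB => ?_⟩
    have h1 := hu φ B hB
    calc ‖(c • u) φ‖ = ‖c‖ * ‖u φ‖ := norm_mul _ _
      _ ≤ ‖c‖ * (C * B) := mul_le_mul_of_nonneg_left h1 (norm_nonneg c)
      _ = ‖c‖ * C * B := by ring

theorem contDiff_fourier (k : ℤ) :
    ContDiff ℝ (⊤ : ℕ∞) (fun x : ℝ => (fourier k (x : UnitAddCircle) : ℂ)) := by
  simp only [fourier_coe_apply]
  have h : ContDiff ℝ (⊤ : ℕ∞) (fun x : ℝ => (x : ℂ)) := Complex.ofRealCLM.contDiff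
  fun_prop

/-- The complex sinusoid `e_k` as a test function. -/
def e (k : ℤ) : PerTest := ⟨fun t => fourier k t, contDiff_fourier k⟩

/-- The `k`-th Fourier coefficient `⟨u, e_k⟩ = u (e_{-k})` of a periodic generalized function. -/
def fc (u : PerDist) (k : ℤ) : ℂ := u.1 (e (-k))

/-- The complex conjugate of a test function. -/
def conjTest (φ : PerTest) : PerTest :=
  ⟨fun t => (starRingEnd ℂ) (φ.1 t), by
    have h : ContDiff ℝ (⊤ : ℕ∞) (fun x : ℝ => φ.1 (x : UnitAddCircle)) := φ.2
    exact Complex.conjCLE.contDiff.comp h⟩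

/-- The translate `φ (· - τ)` of a test function. -/
def translate (τ : ℝ) (φ : PerTest) : PerTest :=
  ⟨fun t => φ.1 (t - (τ : UnitAddCircle)), by
    have h : ContDiff ℝ (⊤ : ℕ∞) (fun x : ℝ => φ.1 ((x - τ : ℝ) : UnitAddCircle)) :=
      ContDiff.comp (g := fun x : ℝ => φ.1 (x : UnitAddCircle)) φ.2
        (contDiff_id.sub contDiff_const)
    exact h⟩

/-- A periodic generalized function is real if its bracket commutes with conjugation. -/
def IsRealDist (u : PerDist) : Prop :=
  ∀ φ : PerTest, u.1 (conjTest φ) = (starRingEnd ℂ) (u.1 φ)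

/-- The Dirac comb `∑ₙ δ(· - t₀ - n)`, that is, the Dirac mass at the point `t₀` of the circle. -/
def diracComb (t₀ : UnitAddCircle) : PerDist :=
  ⟨{ toFun := fun φ => φ.1 t₀
     map_add' := fun _ _ => rfl
     map_smul' := fun _ _ => rfl }, by
    refine ⟨0, 1, fun φ B hB => ?_⟩
    obtain ⟨x, rfl⟩ := QuotientAddGroup.mk_surjective t₀
    simpa using hB 0 le_rfl x⟩

/-- The square-integrable function `f` is the periodic generalized function `u`. -/
def Represents (f : L2) (u : PerDist) : Prop :=
  ∀ φ : PerTest, u.1 φ = ∫ t, f t * φ.1 t ∂haar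

/-- `‖u - g‖²` in `L²`, equal to `∞` if the generalized function `u` is not in `L²`. -/
def l2DistSq (u : PerDist) (g : L2) : ℝ≥0∞ :=
  ⨅ (f : L2) (_ : Represents f u), ‖f - g‖ₑ ^ 2

/-! ### Linear shift-invariant operators -/

/-- A continuous, linear, shift-invariant, real operator from smooth periodic functions to
periodic generalized functions. -/
structure LSIOperator where
  /-- the operator -/
  toLin : PerTest →ₗ[ℂ] PerDist
  /-- continuity, for the weak topology of the target -/
  continuous_apply : ∀ ψ : PerTest, ∃ (N : ℕ) (C : ℝ), ∀ (φ : PerTest) (B : ℝ),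
    (∀ j ≤ N, ∀ x : ℝ, ‖iteratedDeriv j (fun x : ℝ => φ.1 (x : UnitAddCircle)) x‖ ≤ B) →
      ‖(toLin φ).1 ψ‖ ≤ C * B
  /-- shift invariance: `L (φ(· - τ)) = (L φ)(· - τ)` -/
  shift_invariant : ∀ (τ : ℝ) (φ ψ : PerTest),
    (toLin (translate τ φ)).1 (translate τ ψ) = (toLin φ).1 ψ
  /-- the operator maps real functions to real generalized functions -/
  real : ∀ φ ψ : PerTest,
    (toLin (conjTest φ)).1 (conjTest ψ) = (starRingEnd ℂ) ((toLin φ).1 ψ)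

namespace LSIOperator

variable (L : LSIOperator)

/-- The frequency response `L̂[k]`, the number with `L e_k = L̂[k] e_k`. -/
def freq (k : ℤ) : ℂ := fc (L.toLin (e k)) k

/-- The null space of (the extension to generalized functions of) `L`. The extension multiplies
the `k`-th Fourier coefficient by `L̂[k]`. -/
def nullSpace : Submodule ℂ PerDist where
  carrier := {f | ∀ k, L.freq k * fc f k = 0}
  add_mem' := by
    intro f g hf hg k
    have h : fc (f + g) k = fc f k + fc g k := rfl
    rw [h, mul_add, hf k, hg k, add_zero]
  zero_mem' := fun k => by
    have h : fc (0 : PerDist) k = 0 := rfl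
    rw [h, mul_zero]
  smul_mem' := by
    intro c f hf k
    have h : fc (c • f) k = c * fc f k := rfl
    rw [h, mul_left_comm, hf k, mul_zero]

/-- The frequency response of `L_γ = L + γ Proj`, where `Proj` is the projection on the null space
of `L`, which keeps the Fourier coefficients at the zeros of `L̂` and kills the others. -/
def freqReg (γ : ℝ) (k : ℤ) : ℂ :=
  open Classical in L.freq k + (γ : ℂ) * (if L.freq k = 0 then 1 else 0)

/-- The norm of the native space `H_L = {f | L f ∈ L²}`, for `f` with Fourier coefficients `c`:
`‖f‖² = ‖L f‖² + γ² ‖Proj f‖² = ‖L_γ f‖²`, computed by Parseval's identity. It is `∞` if and only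
if `f` is not in `H_L`. -/
def nativeNorm (γ : ℝ) (c : ℤ → ℂ) : ℝ≥0∞ :=
  (∑' k, ‖L.freqReg γ k * c k‖ₑ ^ 2) ^ (1 / 2 : ℝ)

/-- `ν` belongs to the dual of `H_L`: it is bounded for the norm of `H_L` on smooth periodic
functions (which are dense in `H_L`). -/
def MemDual (γ : ℝ) (ν : PerDist) : Prop :=
  ∃ C : ℝ≥0, ∀ φ : PerTest, ‖ν.1 φ‖ₑ ≤ C * L.nativeNorm γ (fourierCoeff φ.1)

/-- The native space `H_L` is a reproducing-kernel Hilbert space: all shifted Dirac combs belong to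
its dual. -/
def IsRKHS (γ : ℝ) : Prop := ∀ t₀ : UnitAddCircle, L.MemDual γ (diracComb t₀)

/-- The Fourier coefficients of the reproducing kernel: `1 / γ²` at the null-space frequencies and
`1 / |L̂[k]|²` at the others. -/
def kernelCoeff (γ : ℝ) (k : ℤ) : ℝ :=
  open Classical in if L.freq k = 0 then 1 / γ ^ 2 else 1 / ‖L.freq k‖ ^ 2

/-- The function `h_γ`; the reproducing kernel of `H_L` is `h_γ (t - τ)`. -/
def kernel (γ : ℝ) (t : UnitAddCircle) : ℂ :=
  ∑' k : ℤ, (L.kernelCoeff γ k : ℂ) * fourier k t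

end LSIOperator

/-- The terms of the bracket `⟨ν, f⟩ = ∑ₖ f̂[k] ⟨ν, e_k⟩`. -/
def bracketTerm (ν : PerDist) (f : UnitAddCircle → ℂ) (k : ℤ) : ℂ :=
  fourierCoeff f k * ν.1 (e k)

/-- The (bilinear) bracket `⟨ν, f⟩` of `ν` in the dual of `H_L` and `f` in `H_L`: the extension of
the bracket with test functions by continuity, along the Fourier series of `f`. -/
def bracket (ν : PerDist) (f : UnitAddCircle → ℂ) : ℂ := ∑' k, bracketTerm ν f k

/-- The periodic convolution `(h ∗ ν)(t) = ⟨ν, h (t - ·)⟩`. -/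
def conv (h : UnitAddCircle → ℂ) (ν : PerDist) (t : UnitAddCircle) : ℂ :=
  bracket ν (fun τ => h (t - τ))

/-- The Gram matrix `G_{m n} = ∫∫ ν_m(t) h(t - τ) ν_n(τ) dt dτ = ⟨ν_m, h ∗ ν_n⟩`. -/
def gram {M : ℕ} (h : UnitAddCircle → ℂ) (ν : Fin M → PerDist) : Matrix (Fin M) (Fin M) ℂ :=
  Matrix.of fun m n => bracket (ν m) (conv h (ν n))

/-! ### Fourier coefficients determine a periodic generalized function -/

theorem exists_deriv_eq (φ : PerTest) : ∃ ψ : PerTest,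
    deriv (fun x : ℝ => φ.1 (x : UnitAddCircle)) = fun x : ℝ => ψ.1 (x : UnitAddCircle) := by
  have h1 : ContDiff ℝ (⊤ : ℕ∞) (fun x : ℝ => φ.1 (x : UnitAddCircle)) := φ.2
  have hper : Function.Periodic (deriv (fun x : ℝ => φ.1 (x : UnitAddCircle))) 1 := by
    intro x
    rw [← deriv_comp_add_const]
    congr 1
    funext z
    simp
  refine ⟨⟨hper.lift, ?_⟩, ?_⟩
  · have : ContDiff ℝ (⊤ : ℕ∞) (deriv (fun x : ℝ => φ.1 (x : UnitAddCircle))) :=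
      ((contDiff_infty_iff_deriv (f := fun x : ℝ => φ.1 (x : UnitAddCircle))).1 h1).2
    exact this
  · funext x
    exact (hper.lift_coe x).symm

theorem fourierCoeff_of_deriv (φ ψ : PerTest)
    (h : deriv (fun x : ℝ => φ.1 (x : UnitAddCircle)) = fun x : ℝ => ψ.1 (x : UnitAddCircle))
    (k : ℤ) : fourierCoeff ψ.1 k = 2 * Real.pi * Complex.I * k * fourierCoeff φ.1 k := by
  have h1 : ContDiff ℝ (⊤ : ℕ∞) (fun x : ℝ => φ.1 (x : UnitAddCircle)) := φ.2
  have h2 : ContDiff ℝ (⊤ : ℕ∞) (fun x : ℝ => ψ.1 (x : UnitAddCircle)) := ψ.2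
  rw [fourierCoeff_eq_intervalIntegral _ _ 0, fourierCoeff_eq_intervalIntegral _ _ 0]
  have hd : ∀ x : ℝ, HasDerivAt (fun x : ℝ => φ.1 (x : UnitAddCircle)) (ψ.1 x) x := by
    intro x
    have := (h1.differentiable (by simp) x).hasDerivAt
    rwa [h] at this
  have key := intervalIntegral.integral_mul_deriv_eq_deriv_mul
    (u := fun x : ℝ => (fourier (-k) (x : UnitAddCircle) : ℂ))
    (v := fun x : ℝ => φ.1 (x : UnitAddCircle)) (a := 0) (b := 0 + 1)
    (fun x _ => hasDerivAt_fourier_neg 1 k x) (fun x _ => hd x)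
    (Continuous.intervalIntegrable (by fun_prop) _ _)
    (Continuous.intervalIntegrable h2.continuous _ _)
  simp only [smul_eq_mul]
  rw [key]
  have e0 : ((0 + 1 : ℝ) : UnitAddCircle) = ((0 : ℝ) : UnitAddCircle) := by simp
  rw [e0, sub_self, zero_sub]
  simp only [mul_assoc]
  simp only [Complex.ofReal_one, ne_eq, one_ne_zero, not_false_eq_true, div_self, one_smul,
    div_one, intervalIntegral.integral_const_mul]
  ring

theorem summable_fourierCoeff (φ : PerTest) : Summable fun k => ‖fourierCoeff φ.1 k‖ := by
  obtain ⟨φ1, h1⟩ := exists_deriv_eq φ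
  obtain ⟨φ2, h2⟩ := exists_deriv_eq φ1
  have hc : ContDiff ℝ (⊤ : ℕ∞) (fun x : ℝ => φ2.1 (x : UnitAddCircle)) := φ2.2
  have hb : ∃ B, ∀ k, ‖fourierCoeff φ2.1 k‖ ≤ B := by
    refine ⟨∫ x in (0 : ℝ)..1, ‖φ2.1 (x : UnitAddCircle)‖, fun k => ?_⟩
    rw [fourierCoeff_eq_intervalIntegral _ _ 0]
    simp only [zero_add, ne_eq, one_ne_zero, not_false_eq_true, div_self, one_smul]
    refine (intervalIntegral.norm_integral_le_integral_norm zero_le_one).trans (le_of_eq ?_)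
    congr 1
    funext x
    rw [norm_smul, fourier_apply, Circle.norm_coe, one_mul]
  obtain ⟨B, hB⟩ := hb
  have hs : Summable fun k : ℤ => B * (1 / (k : ℝ) ^ 2) :=
    (Real.summable_one_div_int_pow.2 one_lt_two).mul_left B
  refine hs.of_norm_bounded_eventually ?_
  have : ∀ᶠ k : ℤ in cofinite, k ≠ 0 := (Set.finite_singleton (0 : ℤ)).eventually_cofinite_notMem
  filter_upwards [this] with k hk
  rw [norm_norm]
  have h3 := hB k
  rw [fourierCoeff_of_deriv _ _ h2, fourierCoeff_of_deriv _ _ h1, ← mul_assoc, norm_mul,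
    norm_mul] at h3
  have h4 : ‖(2 * Real.pi * Complex.I * k : ℂ)‖ = 2 * Real.pi * |(k : ℝ)| := by
    simp [abs_of_pos Real.pi_pos]
  rw [h4] at h3
  have hk2 : 0 < (k : ℝ) ^ 2 := by positivity
  rw [mul_one_div, le_div_iff₀ hk2]
  refine le_trans ?_ h3
  have h5 : (k : ℝ) ^ 2 ≤ 2 * Real.pi * |(k : ℝ)| * (2 * Real.pi * |(k : ℝ)|) := by
    have : 2 * Real.pi * |(k : ℝ)| * (2 * Real.pi * |(k : ℝ)|) = (2 * Real.pi) ^ 2 * (k : ℝ) ^ 2 := by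
      rw [← sq_abs (k : ℝ)]; ring
    rw [this]
    have : 1 ≤ (2 * Real.pi) ^ 2 := by nlinarith [Real.pi_gt_three]
    nlinarith
  calc _ = (k : ℝ) ^ 2 * ‖fourierCoeff φ.1 k‖ := mul_comm _ _
    _ ≤ _ := mul_le_mul_of_nonneg_right h5 (norm_nonneg _)

theorem norm_apply_le (φ : PerTest) (t : UnitAddCircle) :
    ‖φ.1 t‖ ≤ ∑' k, ‖fourierCoeff φ.1 k‖ := by
  have hc : Continuous φ.1 := by
    have h1 : ContDiff ℝ (⊤ : ℕ∞) (fun x : ℝ => φ.1 (x : UnitAddCircle)) := φ.2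
    exact QuotientAddGroup.isOpenQuotientMap_mk.isQuotientMap.continuous_iff.2 h1.continuous
  have hs := summable_fourierCoeff φ
  have h := has_pointwise_sum_fourier_series_of_summable (f := ⟨φ.1, hc⟩) (Summable.of_norm hs) t
  have h' : HasSum (fun k => fourierCoeff φ.1 k • (fourier k t : ℂ)) (φ.1 t) := h
  rw [← h'.tsum_eq]
  have e : (fun k => ‖fourierCoeff φ.1 k • (fourier k t : ℂ)‖) = fun k => ‖fourierCoeff φ.1 k‖ := by
    funext k
    rw [norm_smul, fourier_apply, Circle.norm_coe, mul_one]
  have := norm_tsum_le_tsum_norm (f := fun k => fourierCoeff φ.1 k • (fourier k t : ℂ))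
    (by rw [e]; exact hs)
  rwa [e] at this

theorem exists_iteratedDeriv_eq (j : ℕ) : ∀ (φ : PerTest), ∃ ψ : PerTest,
    (iteratedDeriv j (fun x : ℝ => φ.1 (x : UnitAddCircle)) = fun x : ℝ => ψ.1 (x : UnitAddCircle))
    ∧ ∀ k : ℤ, fourierCoeff ψ.1 k = (2 * Real.pi * Complex.I * k) ^ j * fourierCoeff φ.1 k := by
  induction j with
  | zero => exact fun φ => ⟨φ, by simp, by simp⟩
  | succ j ih =>
    intro φ
    obtain ⟨φ1, h1⟩ := exists_deriv_eq φ
    obtain ⟨ψ, h2, h3⟩ := ih φ1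
    refine ⟨ψ, ?_, fun k => ?_⟩
    · rw [iteratedDeriv_succ', h1, h2]
    · rw [h3, fourierCoeff_of_deriv _ _ h1]; ring

/-- The Fourier series of a test function converges in the sense of the bracket with any periodic
generalized function, so `bracket` extends the bracket with test functions. -/
theorem hasSum_bracketTerm (u : PerDist) (φ : PerTest) :
    HasSum (bracketTerm u φ.1) (u.1 φ) := by
  obtain ⟨N, C, hu⟩ := u.2
  set a : ℕ → ℤ → ℝ := fun j k => ‖(2 * Real.pi * Complex.I * k : ℂ) ^ j * fourierCoeff φ.1 k‖
    with ha
  have hsum : ∀ j, Summable (a j) := by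
    intro j
    obtain ⟨ψ, -, h⟩ := exists_iteratedDeriv_eq j φ
    have := summable_fourierCoeff ψ
    simpa only [h] using this
  have hint : ∀ ψ : PerTest, Integrable ψ.1 haar := by
    intro ψ
    have h1 : ContDiff ℝ (⊤ : ℕ∞) (fun x : ℝ => ψ.1 (x : UnitAddCircle)) := ψ.2
    have hc : Continuous ψ.1 :=
      QuotientAddGroup.isOpenQuotientMap_mk.isQuotientMap.continuous_iff.2 h1.continuous
    exact hc.integrable_of_hasCompactSupport (HasCompactSupport.of_compactSpace _)
  let Fc : ℤ → PerTest →ₗ[ℂ] ℂ := fun k =>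
    { toFun := fun ψ => fourierCoeff ψ.1 k
      map_add' := fun ψ χ => by
        have := congrFun (fourierCoeff.add (hint ψ) (hint χ)) k
        exact this
      map_smul' := fun c ψ => fourierCoeff.const_smul ψ.1 c k }
  let r : Finset ℤ → PerTest := fun s => φ - ∑ k ∈ s, fourierCoeff φ.1 k • e k
  have hr : ∀ s k, fourierCoeff (r s).1 k = if k ∈ s then 0 else fourierCoeff φ.1 k := by
    intro s k
    change Fc k (r s) = _
    simp only [r, map_sub, map_sum, map_smul]
    have he : ∀ i, Fc k (e i) = if k = i then 1 else 0 := by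
      intro i
      have : Fc k (e i) = fourierCoeff (fourier (T := 1) i) k := rfl
      rw [this, fourierCoeff_fourier, Pi.single_apply]
    have hφ : Fc k φ = fourierCoeff φ.1 k := rfl
    simp only [he, hφ, smul_eq_mul, mul_ite, mul_one, mul_zero, Finset.sum_ite_eq]
    split_ifs <;> simp
  have hbound : ∀ s, ‖u.1 φ - ∑ k ∈ s, bracketTerm u φ.1 k‖ ≤
      C * ∑ j ∈ Finset.range (N + 1), ∑' k : {k // k ∉ s}, a j k := by
    intro s
    have h1 : u.1 φ - ∑ k ∈ s, bracketTerm u φ.1 k = u.1 (r s) := by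
      simp only [r, map_sub, map_sum, map_smul, bracketTerm, smul_eq_mul]
    rw [h1]
    refine hu _ _ fun j hj x => ?_
    obtain ⟨ψ, h2, h3⟩ := exists_iteratedDeriv_eq j (r s)
    rw [h2]
    refine (norm_apply_le ψ x).trans ?_
    have h4 : ∑' k, ‖fourierCoeff ψ.1 k‖ = ∑' k : {k // k ∉ s}, a j k := by
      have : (fun k => ‖fourierCoeff ψ.1 k‖) = Set.indicator {k | k ∉ s} (a j) := by
        funext k
        rw [h3, hr]
        by_cases hk : k ∈ s <;> simp [hk, ha]
      rw [this]
      exact (tsum_subtype {k | k ∉ s} (a j)).symm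
    rw [h4]
    refine Finset.single_le_sum (f := fun j => ∑' k : {k // k ∉ s}, a j k)
      (fun i _ => tsum_nonneg fun _ => norm_nonneg _) (Finset.mem_range.2 (by omega))
  have hlim : Tendsto (fun s : Finset ℤ =>
      C * ∑ j ∈ Finset.range (N + 1), ∑' k : {k // k ∉ s}, a j k) atTop (𝓝 0) := by
    have : Tendsto (fun s : Finset ℤ => ∑ j ∈ Finset.range (N + 1), ∑' k : {k // k ∉ s}, a j k)
        atTop (𝓝 (∑ j ∈ Finset.range (N + 1), 0)) :=
      tendsto_finsetSum _ fun j _ => tendsto_tsum_compl_atTop_zero (a j)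
    simpa using this.const_mul C
  rw [HasSum, SummationFilter.unconditional_filter, tendsto_iff_norm_sub_tendsto_zero]
  refine squeeze_zero (fun _ => norm_nonneg _) (fun s => ?_) hlim
  rw [norm_sub_rev]
  exact hbound s

/-- A periodic generalized function is determined by its Fourier coefficients. -/
theorem ext_fc (u v : PerDist) (h : ∀ k, fc u k = fc v k) : u = v := by
  refine Subtype.ext (LinearMap.ext fun φ => ?_)
  have h' : ∀ k, u.1 (e k) = v.1 (e k) := fun k => by simpa [fc] using h (-k)
  refine (hasSum_bracketTerm u φ).unique ?_
  have := hasSum_bracketTerm v φ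
  have h2 : bracketTerm u φ.1 = bracketTerm v φ.1 := funext fun k => by
    simp only [bracketTerm, h']
  rwa [h2]

/-! ### Gaussian bridges, measurements and estimators -/

/-- A periodic Gaussian white noise: a real random generalized function whose brackets with real
test functions form a centered Gaussian process with covariance `E[⟨w, f⟩⟨w, g⟩] = ∫ f g`. -/
structure IsWhiteNoise {Ω : Type*} [MeasurableSpace Ω] (P : Measure Ω) (w : Ω → PerDist) :
    Prop where
  real : ∀ᵐ ω ∂P, IsRealDist (w ω)
  gaussian : IsGaussianProcess
    (fun (φ : {φ : PerTest // conjTest φ = φ}) (ω : Ω) => ((w ω).1 φ.1).re) P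
  centered : ∀ φ : PerTest, conjTest φ = φ → ∫ ω, ((w ω).1 φ).re ∂P = 0
  covariance : ∀ φ ψ : PerTest, conjTest φ = φ → conjTest ψ = ψ →
    ∫ ω, ((w ω).1 φ).re * ((w ω).1 ψ).re ∂P = ∫ t, (φ.1 t).re * (ψ.1 t).re ∂haar

/-- `s` is a Gaussian bridge with parameters `L` and `γ²`: a solution of `L_γ s = w` with `w` a
periodic Gaussian white noise. The equation is written in terms of Fourier coefficients. -/
def IsGaussianBridge {Ω : Type*} [MeasurableSpace Ω] (P : Measure Ω) (L : LSIOperator) (γ : ℝ)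
    (s : Ω → PerDist) : Prop :=
  ∃ w : Ω → PerDist, IsWhiteNoise P w ∧
    ∀ᵐ ω ∂P, ∀ k, L.freqReg γ k * fc (s ω) k = fc (w ω) k

/-- The random variable `x` is the measurement `⟨ν, s⟩ = ∑ₖ ŝ[k] ⟨ν, e_k⟩`, the symmetric series
converging in mean square. -/
def IsMeasurement {Ω : Type*} [MeasurableSpace Ω] (P : Measure Ω) (s : Ω → PerDist)
    (ν : PerDist) (x : Ω → ℝ) : Prop :=
  MemLp x 2 P ∧
  Tendsto (fun N : ℕ => eLpNorm
    (fun ω => ∑ k ∈ Finset.Icc (-(N : ℤ)) N, fc (s ω) k * ν.1 (e k) - (x ω : ℂ)) 2 P)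
    atTop (𝓝 0)

/-- The mean-square error `E ‖s - S(y)‖²` of the estimator `S(y)` of the whole process `s`. -/
def mse {Ω : Type*} [MeasurableSpace Ω] (P : Measure Ω) (s : Ω → PerDist) {M : ℕ}
    (y : Fin M → Ω → ℝ) (S : (Fin M → ℝ) → L2) : ℝ≥0∞ :=
  ∫⁻ ω, l2DistSq (s ω) (S fun m => y m ω) ∂P

/-- `S(y)` is a minimum mean-square error estimator of the process `s` given `y`: a measurable
function of `y` with values in `L²`, with finite error, that minimizes the error among all of
them. -/
def IsMMSE {Ω : Type*} [MeasurableSpace Ω] (P : Measure Ω) (s : Ω → PerDist) {M : ℕ}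
    (y : Fin M → Ω → ℝ) (S : (Fin M → ℝ) → L2) : Prop :=
  StronglyMeasurable S ∧ mse P s y S ≠ ∞ ∧
    ∀ F : (Fin M → ℝ) → L2, StronglyMeasurable F → mse P s y S ≤ mse P s y F

end PeriodicMMSE

end

noncomputable section

namespace PeriodicMMSE

/-! ### Sinusoids and Fourier series -/

/-! The problem is diagonal in the Fourier basis. Write `ĥ[k]` for `L.kernelCoeff γ k`, which equals
`1 / ‖L.freqReg γ k‖²`. Dividing the equation of the bridge by `L.freqReg γ k` shows that the
coefficients `ŝ[k]` are centered, jointly Gaussian and mutually uncorrelated, with variance `ĥ[k]`.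
By Parseval and Tonelli the mean-square error of an estimator is the sum over `k` of the errors on
`ŝ[k]` (`mse_eq_tsum`), so each coefficient can be estimated separately.

For fixed `k`, passing to the limit in the series of a measurement gives `E[ŝ[k] y_m] = ĥ[k] conj
(ν_m(e_k))` and `E[y_m y_n] = (G + σ² I)_{mn}`. The normal equations then give the linear regression
of `ŝ[k]` on `y` (`regression`). Its residual is centered and uncorrelated with `y`; since
everything is jointly Gaussian (`IsGaussianBridge.hasGaussianLaw_joint`), it is independent of `y`.
Pythagoras for each `k`, summed over `k`, gives `mse F = mse S + E ‖F(y) - S(y)‖²` (`mse_eq_add`).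
This yields optimality at once, and uniqueness once the error of `S` is finite.

Two facts complete the argument. The numbers `ĥ[k] conj (ν_m(e_k))` are exactly the Fourier
coefficients of `φ_m = h ∗ ν_m` (`conv_kernel_eq`), so the regressions reassemble into `∑ d_m φ_m`.
Finiteness comes from `∑ ĥ[k] < ∞`, which is what membership of a Dirac comb in the dual says
(`summable_kernelCoeff`): this sum is the error of the zero estimator. -/

theorem conjTest_e (k : ℤ) : conjTest (e k) = e (-k) :=
  Subtype.ext (funext fun _ => fourier_neg.symm)

theorem IsRealDist.apply_e_neg {ν : PerDist} (h : IsRealDist ν) (k : ℤ) :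
    ν.1 (e (-k)) = (starRingEnd ℂ) (ν.1 (e k)) := by
  rw [← conjTest_e, h]

theorem norm_fourier_apply (k : ℤ) (t : UnitAddCircle) : ‖(fourier k t : ℂ)‖ = 1 := by
  rw [fourier_apply, Circle.norm_coe]

theorem PerTest.continuous (φ : PerTest) : Continuous φ.1 := by
  have h1 : ContDiff ℝ (⊤ : ℕ∞) (fun x : ℝ => φ.1 (x : UnitAddCircle)) := φ.2
  exact QuotientAddGroup.isOpenQuotientMap_mk.isQuotientMap.continuous_iff.2 h1.continuous

theorem fourierCoeff_sum_smul_e (F : Finset ℤ) (c : ℤ → ℂ) (j : ℤ) :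
    fourierCoeff (∑ k ∈ F, c k • e k).1 j = if j ∈ F then c j else 0 := by
  have h1 : (∑ k ∈ F, c k • e k).1 = ∑ k ∈ F, c k • (e k).1 := by
    simp
  rw [h1, fourierCoeff.sum, Finset.sum_apply]
  · have h2 : ∀ k, fourierCoeff (c k • (e k).1) j = if j = k then c k else 0 := by
      intro k
      have : fourierCoeff (e k).1 j = Pi.single (M := fun _ => ℂ) k 1 j :=
        congrFun (fourierCoeff_fourier (T := 1) k) j
      rw [fourierCoeff.const_smul, this, Pi.single_apply]
      simp
    simp only [h2, Finset.sum_ite_eq]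
  · intro k _
    exact ((PerTest.continuous (c k • e k))).integrable_of_hasCompactSupport
      (HasCompactSupport.of_compactSpace _)

/-- An absolutely convergent Fourier series as a continuous function. -/
theorem hasSum_fourier_series {c : ℤ → ℂ} (hc : Summable c) :
    ∃ F : C(UnitAddCircle, ℂ), (∀ t, HasSum (fun k => c k * fourier k t) (F t)) ∧
      ∀ k, fourierCoeff F k = c k := by
  have hs : Summable fun k => c k • (fourier k : C(UnitAddCircle, ℂ)) := by
    refine Summable.of_norm ?_
    simpa only [norm_smul, fourier_norm, mul_one] using hc.norm
  obtain ⟨F, hF⟩ := hs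
  refine ⟨F, fun t => (ContinuousMap.evalCLM ℂ t).hasSum hF, fun k => ?_⟩
  -- Uniform convergence passes to `L²`, where the inner product with `e_k` retains only the term `c
  -- k`.
  have h1 := (ContinuousMap.toLp (E := ℂ) 2 haar ℂ).hasSum hF
  have h2 := (innerSL ℂ (fourierLp (T := 1) 2 k)).hasSum h1
  have h3 : ((innerSL ℂ (fourierLp (T := 1) 2 k)) ∘ (ContinuousMap.toLp (E := ℂ) 2 haar ℂ) ∘
      fun k => c k • (fourier k : C(UnitAddCircle, ℂ))) = fun j => if j = k then c k else 0 := by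
    funext j
    have h4 := orthonormal_iff_ite.1 (orthonormal_fourier (T := 1)) k j
    simp only [Function.comp_apply, map_smul, innerSL_apply_apply, smul_eq_mul]
    change c j * inner ℂ (fourierLp 2 k) (fourierLp 2 j) = _
    rw [h4]
    by_cases hjk : j = k
    · subst hjk; simp
    · simp [hjk, Ne.symm hjk]
  have h5 := h2.unique (h3 ▸ hasSum_ite_eq k (c k))
  rw [← h5, ← fourierCoeff_toLp, ← fourierBasis_repr, HilbertBasis.repr_apply_apply,
    coe_fourierBasis]
  rfl

/-- Parseval's identity in `[0, ∞]`. -/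
theorem enorm_sq_eq_tsum (f : L2) : ‖f‖ₑ ^ 2 = ∑' k, ‖fourierCoeff f k‖ₑ ^ 2 := by
  have h1 : HasSum (fun i => ‖fourierBasis.repr f i‖ ^ 2) (‖fourierBasis.repr f‖ ^ 2) := by
    simpa using lp.hasSum_norm (by simp) (fourierBasis.repr f)
  rw [LinearIsometryEquiv.norm_map] at h1
  simp only [fourierBasis_repr] at h1
  have h2 := ENNReal.ofReal_tsum_of_nonneg (fun _ => by positivity) h1.summable
  rw [h1.tsum_eq] at h2
  simpa only [← ofReal_norm, ENNReal.ofReal_pow (norm_nonneg _)] using h2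

theorem fourierCoeff_L2_sub (f g : L2) (k : ℤ) :
    fourierCoeff (f - g : L2) k = fourierCoeff f k - fourierCoeff g k := by
  simp only [← fourierBasis_repr, map_sub]
  rfl

/-- Riesz–Fischer. -/
theorem exists_fourierCoeff_eq {c : ℤ → ℂ} (hc : ∑' k, ‖c k‖ₑ ^ 2 ≠ ∞) :
    ∃ f : L2, ∀ k, fourierCoeff f k = c k := by
  have hm : Memℓp c 2 := by
    refine memℓp_gen ?_
    have := ENNReal.summable_toReal hc
    simpa using this
  refine ⟨fourierBasis.repr.symm ⟨c, hm⟩, fun k => ?_⟩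
  rw [← fourierBasis_repr, LinearIsometryEquiv.apply_symm_apply]

/-! ### Square-integrable functions as periodic generalized functions -/

theorem integrable_mul_test (f : L2) (φ : PerTest) :
    Integrable (fun t => f t * φ.1 t) haar := by
  have h1 : Integrable (fun t => f t) haar := (Lp.memLp f).integrable (by norm_num)
  obtain ⟨C, hC⟩ := isCompact_univ.exists_bound_of_continuousOn (PerTest.continuous φ).continuousOn
  exact h1.mul_bdd (c := C) (PerTest.continuous φ).aestronglyMeasurable
    (ae_of_all _ fun t => hC t (Set.mem_univ t))

/-- The periodic generalized function `φ ↦ ∫ f φ` of a square-integrable function `f`. -/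
def ofL2 (f : L2) : PerDist :=
  ⟨{ toFun := fun φ => ∫ t, f t * φ.1 t ∂haar
     map_add' := fun φ ψ => by
      rw [← integral_add (integrable_mul_test f φ) (integrable_mul_test f ψ)]
      refine integral_congr_ae (ae_of_all _ fun t => ?_)
      change f t * (φ.1 t + ψ.1 t) = _
      ring
     map_smul' := fun c φ => by
      rw [RingHom.id_apply, smul_eq_mul, ← integral_const_mul]
      refine integral_congr_ae (ae_of_all _ fun t => ?_)
      change f t * (c * φ.1 t) = _
      ring }, by
    refine ⟨0, ∫ t, ‖f t‖ ∂haar, fun φ B hB => ?_⟩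
    have hφ : ∀ t, ‖φ.1 t‖ ≤ B := by
      intro t
      obtain ⟨x, rfl⟩ := QuotientAddGroup.mk_surjective t
      simpa using hB 0 le_rfl x
    have h1 : Integrable (fun t => f t) haar := (Lp.memLp f).integrable (by norm_num)
    rw [← integral_mul_const]
    refine norm_integral_le_of_norm_le (h1.norm.mul_const B) (ae_of_all _ fun t => ?_)
    rw [norm_mul]
    exact mul_le_mul_of_nonneg_left (hφ t) (norm_nonneg _)⟩

theorem fc_ofL2 (f : L2) (k : ℤ) : fc (ofL2 f) k = fourierCoeff f k := by
  refine integral_congr_ae (ae_of_all _ fun t => ?_)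
  change f t * fourier (-k) t = fourier (-k) t * f t
  ring

theorem represents_iff (f : L2) (u : PerDist) :
    Represents f u ↔ ∀ k, fc u k = fourierCoeff f k := by
  constructor
  · intro h k
    rw [← fc_ofL2]
    exact h _
  · intro h φ
    have : u = ofL2 f := ext_fc _ _ fun k => by rw [h, fc_ofL2]
    rw [this]
    rfl

/-- Parseval's identity for the `L²` distance of a periodic generalized function to `g`. -/
theorem l2DistSq_eq_tsum (u : PerDist) (g : L2) :
    l2DistSq u g = ∑' k, ‖fc u k - fourierCoeff g k‖ₑ ^ 2 := by
  unfold l2DistSq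
  refine le_antisymm ?_ (le_iInf₂ fun f hf => ?_)
  -- If the sum is finite, Riesz–Fischer realizes `u - g` by some `f` in `L²`, and `f + g`
  -- represents `u`. Otherwise the upper bound is trivial.
  · by_cases hfin : ∑' k, ‖fc u k - fourierCoeff g k‖ₑ ^ 2 = ∞
    · rw [hfin]; exact le_top
    · obtain ⟨f, hf⟩ := exists_fourierCoeff_eq hfin
      have hr : Represents (f + g) u := by
        rw [represents_iff]
        intro k
        have := fourierCoeff_L2_sub (f + g) g k
        rw [add_sub_cancel_right, hf] at this
        exact sub_left_injective this
      refine (iInf₂_le (f + g) hr).trans (le_of_eq ?_)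
      rw [add_sub_cancel_right, enorm_sq_eq_tsum]
      simp only [hf]
  · rw [enorm_sq_eq_tsum]
    simp only [fourierCoeff_L2_sub, (represents_iff f u).1 hf, le_refl]

/-! ### The frequency response and the dual of the native space -/

namespace LSIOperator

variable (L : LSIOperator)

theorem freq_neg (k : ℤ) : L.freq (-k) = (starRingEnd ℂ) (L.freq k) := by
  have h := L.real (e k) (e (-k))
  rw [conjTest_e, conjTest_e] at h
  exact h

theorem kernelCoeff_neg (γ : ℝ) (k : ℤ) : L.kernelCoeff γ (-k) = L.kernelCoeff γ k := by
  classical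
  unfold kernelCoeff
  rw [freq_neg]
  simp

variable {γ : ℝ}

theorem freqReg_ne_zero (hγ : 0 < γ) (k : ℤ) : L.freqReg γ k ≠ 0 := by
  classical
  unfold freqReg
  by_cases h : L.freq k = 0 <;> simp [h, hγ.ne']

theorem kernelCoeff_eq (k : ℤ) : L.kernelCoeff γ k = 1 / ‖L.freqReg γ k‖ ^ 2 := by
  classical
  unfold freqReg kernelCoeff
  by_cases h : L.freq k = 0 <;> simp [h]

theorem kernelCoeff_pos (hγ : 0 < γ) (k : ℤ) : 0 < L.kernelCoeff γ k := by
  rw [kernelCoeff_eq]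
  have := norm_pos_iff.2 (L.freqReg_ne_zero hγ k)
  positivity

/-- Duality: the functional is tested on the trigonometric polynomial that gives equality in
Cauchy–Schwarz. Both its value and its squared native norm are the partial sum `S`, so `S ≤ C √S`
and hence `S ≤ C²`, uniformly in the finite set of frequencies. -/
theorem summable_of_memDual (hγ : 0 < γ) {ν : PerDist} (hν : L.MemDual γ ν) :
    Summable fun k => L.kernelCoeff γ k * ‖ν.1 (e k)‖ ^ 2 := by
  obtain ⟨C, hC⟩ := hν
  have hpos := L.kernelCoeff_pos hγ
  refine summable_of_sum_le (c := (C : ℝ) ^ 2) (fun k => by have := hpos k; positivity) fun F => ?_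
  set S := ∑ k ∈ F, L.kernelCoeff γ k * ‖ν.1 (e k)‖ ^ 2 with hS
  have hS0 : 0 ≤ S := Finset.sum_nonneg fun k _ => by have := hpos k; positivity
  set c : ℤ → ℂ := fun k => (L.kernelCoeff γ k : ℂ) * (starRingEnd ℂ) (ν.1 (e k)) with hc
  have h1 : ν.1 (∑ k ∈ F, c k • e k) = (S : ℂ) := by
    simp only [map_sum, map_smul, smul_eq_mul, hS, hc]
    push_cast
    refine Finset.sum_congr rfl fun k _ => ?_
    rw [mul_assoc, ← Complex.normSq_eq_conj_mul_self, Complex.normSq_eq_norm_sq]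
    push_cast
    rfl
  have h2 : L.nativeNorm γ (fourierCoeff (∑ k ∈ F, c k • e k).1) =
      ENNReal.ofReal (Real.sqrt S) := by
    have h3 : ∑' k, ‖L.freqReg γ k * fourierCoeff (∑ k ∈ F, c k • e k).1 k‖ₑ ^ 2 =
        ENNReal.ofReal S := by
      rw [tsum_eq_sum (s := F), hS, ENNReal.ofReal_sum_of_nonneg]
      · refine Finset.sum_congr rfl fun k hk => ?_
        rw [fourierCoeff_sum_smul_e, if_pos hk, ← ofReal_norm,
          ← ENNReal.ofReal_pow (norm_nonneg _)]
        congr 1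
        have h4 := norm_pos_iff.2 (L.freqReg_ne_zero hγ k)
        simp only [hc, norm_mul, RCLike.norm_conj, Complex.norm_real,
          Real.norm_of_nonneg (hpos k).le]
        rw [kernelCoeff_eq]
        field_simp
      · intro k _
        have := hpos k; positivity
      · intro k hk
        rw [fourierCoeff_sum_smul_e, if_neg hk]
        simp
    rw [nativeNorm, h3, ENNReal.ofReal_rpow_of_nonneg hS0 (by norm_num), Real.sqrt_eq_rpow]
  have h5 := hC (∑ k ∈ F, c k • e k)
  rw [h1, h2, ← ofReal_norm, Complex.norm_real, Real.norm_of_nonneg hS0,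
    ← ENNReal.ofReal_coe_nnreal, ← ENNReal.ofReal_mul C.coe_nonneg,
    ENNReal.ofReal_le_ofReal_iff (by positivity)] at h5
  have h6 := Real.sq_sqrt hS0
  have h7 := Real.sqrt_nonneg S
  rcases h7.eq_or_lt with h8 | h8
  · rw [← h8] at h6; nlinarith [C.2, sq_nonneg (C : ℝ)]
  · have h9 : Real.sqrt S ≤ C := by
      refine le_of_mul_le_mul_right ?_ h8
      nlinarith
    nlinarith

/-- A Dirac mass takes values of modulus one on every sinusoid, so its squared dual norm is the sum
of the kernel coefficients. -/
theorem summable_kernelCoeff (hγ : 0 < γ) (h : L.IsRKHS γ) : Summable (L.kernelCoeff γ) := by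
  have h1 := L.summable_of_memDual hγ (h 0)
  have h2 : ∀ k, ‖(diracComb 0).1 (e k)‖ = 1 := fun k => norm_fourier_apply k 0
  simpa only [h2, one_pow, mul_one] using h1

/-- Domination by `ĥ + ĥ |ν(e_k)|²`: the Dirac mass and `ν` each contribute a summable series. -/
theorem summable_kernelCoeff_mul (hγ : 0 < γ) (h : L.IsRKHS γ) {ν : PerDist}
    (hν : L.MemDual γ ν) : Summable fun k => (L.kernelCoeff γ k : ℂ) * ν.1 (e k) := by
  refine Summable.of_norm_bounded
    ((L.summable_kernelCoeff hγ h).add (L.summable_of_memDual hγ hν)) fun k => ?_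
  have hp := L.kernelCoeff_pos hγ k
  rw [norm_mul, Complex.norm_real, Real.norm_of_nonneg hp.le]
  nlinarith [mul_nonneg hp.le (sq_nonneg (‖ν.1 (e k)‖ - 1)),
    mul_nonneg hp.le (norm_nonneg (ν.1 (e k))), mul_nonneg hp.le (sq_nonneg (‖ν.1 (e k)‖))]

theorem summable_kernelCoeff_mul_mul (hγ : 0 < γ) {ν μ : PerDist}
    (hν : L.MemDual γ ν) (hμ : L.MemDual γ μ) : Summable fun k =>
      (L.kernelCoeff γ k : ℂ) * ν.1 (e k) * (starRingEnd ℂ) (μ.1 (e k)) := by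
  refine Summable.of_norm_bounded
    ((L.summable_of_memDual hγ hν).add (L.summable_of_memDual hγ hμ)) fun k => ?_
  have hp := L.kernelCoeff_pos hγ k
  rw [norm_mul, norm_mul, RCLike.norm_conj, Complex.norm_real, Real.norm_of_nonneg hp.le]
  nlinarith [mul_nonneg hp.le (sq_nonneg (‖ν.1 (e k)‖ - ‖μ.1 (e k)‖)),
    mul_nonneg hp.le (sq_nonneg (‖ν.1 (e k)‖)), mul_nonneg hp.le (sq_nonneg (‖μ.1 (e k)‖))]

/-! ### The reproducing kernel and the functions `h ∗ ν` -/

/-- As a function of `τ`, the kernel series runs over `e_{-k}(τ)`. Reindexing by `k ↦ -k` leaves the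
weights unchanged because the real operator has an even kernel coefficient. -/
theorem fourierCoeff_kernel_sub (hγ : 0 < γ) (h : L.IsRKHS γ) (t : UnitAddCircle) (k : ℤ) :
    fourierCoeff (fun τ => L.kernel γ (t - τ)) k = L.kernelCoeff γ k * fourier (-k) t := by
  have hs : Summable fun k : ℤ => (L.kernelCoeff γ k : ℂ) * fourier (-k) t := by
    refine Summable.of_norm ?_
    simp only [norm_mul, norm_fourier_apply, mul_one]
    simpa using (L.summable_kernelCoeff hγ h).norm
  obtain ⟨F, hF, hFc⟩ := hasSum_fourier_series hs
  have : (fun τ => L.kernel γ (t - τ)) = F := by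
    funext τ
    rw [← (hF τ).tsum_eq, kernel, ← (Equiv.neg ℤ).tsum_eq]
    refine tsum_congr fun j => ?_
    have h1 : (fourier (-j) (t - τ) : ℂ) = fourier (-j) t * fourier j τ := by
      simp only [fourier_apply, ← Circle.coe_mul, ← AddCircle.toCircle_add]
      congr 2
      rw [zsmul_sub, neg_zsmul τ j]
      abel
    rw [Equiv.neg_apply, kernelCoeff_neg, h1, mul_assoc]
  rw [this, hFc]

theorem bracketTerm_kernel_sub (hγ : 0 < γ) (h : L.IsRKHS γ) (ν : PerDist) (t : UnitAddCircle) :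
    (bracketTerm ν fun τ => L.kernel γ (t - τ)) =
      fun k => (L.kernelCoeff γ k : ℂ) * fourier (-k) t * ν.1 (e k) := by
  funext k
  rw [bracketTerm, fourierCoeff_kernel_sub L hγ h]

theorem summable_bracketTerm_kernel (hγ : 0 < γ) (h : L.IsRKHS γ) {ν : PerDist}
    (hν : L.MemDual γ ν) (t : UnitAddCircle) :
    Summable (bracketTerm ν fun τ => L.kernel γ (t - τ)) := by
  rw [L.bracketTerm_kernel_sub hγ h]
  refine Summable.of_norm ?_
  simpa only [norm_mul, norm_fourier_apply, mul_one] using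
    (L.summable_kernelCoeff_mul hγ h hν).norm

/-- Convolution multiplies Fourier coefficients, and realness of `ν` turns `ν(e_{-k})` into a
conjugate. The continuous representative `F` is what later embeds `φ_m` in `L²`. -/
theorem conv_kernel_eq (hγ : 0 < γ) (h : L.IsRKHS γ) {ν : PerDist} (hν : L.MemDual γ ν)
    (hr : IsRealDist ν) :
    ∃ F : C(UnitAddCircle, ℂ), conv (L.kernel γ) ν = F ∧
      ∀ k, fourierCoeff F k = L.kernelCoeff γ k * (starRingEnd ℂ) (ν.1 (e k)) := by
  have hs : Summable fun k : ℤ => (L.kernelCoeff γ k : ℂ) * (starRingEnd ℂ) (ν.1 (e k)) := by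
    refine Summable.of_norm ?_
    simpa only [norm_mul, RCLike.norm_conj] using (L.summable_kernelCoeff_mul hγ h hν).norm
  obtain ⟨F, hF, hFc⟩ := hasSum_fourier_series hs
  refine ⟨F, ?_, hFc⟩
  funext t
  rw [← (hF t).tsum_eq, conv, bracket, bracketTerm_kernel_sub L hγ h, ← (Equiv.neg ℤ).tsum_eq]
  refine tsum_congr fun j => ?_
  rw [Equiv.neg_apply, kernelCoeff_neg, hr.apply_e_neg, neg_neg]
  ring

theorem conv_kernel_im (hγ : 0 < γ) (h : L.IsRKHS γ) {ν : PerDist}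
    (hr : IsRealDist ν) (t : UnitAddCircle) : (conv (L.kernel γ) ν t).im = 0 := by
  rw [← Complex.conj_eq_iff_im, conv, bracket, bracketTerm_kernel_sub L hγ h, Complex.conj_tsum,
    ← (Equiv.neg ℤ).tsum_eq]
  refine tsum_congr fun j => ?_
  simp only [Equiv.neg_apply, kernelCoeff_neg, hr.apply_e_neg, neg_neg, map_mul, Complex.conj_ofReal,
    Complex.conj_conj, fourier_neg]

theorem bracketTerm_conv_kernel (hγ : 0 < γ) (h : L.IsRKHS γ) (μ : PerDist) {ν : PerDist}
    (hν : L.MemDual γ ν) (hr : IsRealDist ν) : bracketTerm μ (conv (L.kernel γ) ν) =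
      fun k => (L.kernelCoeff γ k : ℂ) * μ.1 (e k) * (starRingEnd ℂ) (ν.1 (e k)) := by
  obtain ⟨F, hF, hFc⟩ := L.conv_kernel_eq hγ h hν hr
  funext k
  rw [bracketTerm, hF, hFc]
  ring

end LSIOperator

/-! ### Gaussian random variables: limits, uncorrelation and orthogonality -/

section Probability

variable {Ω : Type*} [MeasurableSpace Ω] {P : Measure Ω}

theorem tendsto_integral_of_tendsto_eLpNorm_two [IsProbabilityMeasure P] {X : ℕ → Ω → ℝ} {Y : Ω → ℝ}
    (hX : ∀ n, MemLp (X n) 2 P) (hY : MemLp Y 2 P)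
    (h : Tendsto (fun n => eLpNorm (X n - Y) 2 P) atTop (𝓝 0)) :
    Tendsto (fun n => ∫ ω, X n ω ∂P) atTop (𝓝 (∫ ω, Y ω ∂P)) := by
  refine tendsto_integral_of_L1' Y hY.aestronglyMeasurable
    (Eventually.of_forall fun n => (hX n).integrable (by norm_num)) ?_
  refine tendsto_of_tendsto_of_tendsto_of_le_of_le tendsto_const_nhds h (fun _ => zero_le)
    fun n => eLpNorm_le_eLpNorm_of_exponent_le (by norm_num) ((hX n).sub hY).aestronglyMeasurable

theorem tendsto_integral_mul_of_tendsto_eLpNorm_two {X X' : ℕ → Ω → ℝ} {Y Y' : Ω → ℝ}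
    (hX : ∀ n, MemLp (X n) 2 P) (hY : MemLp Y 2 P)
    (h : Tendsto (fun n => eLpNorm (X n - Y) 2 P) atTop (𝓝 0))
    (hX' : ∀ n, MemLp (X' n) 2 P) (hY' : MemLp Y' 2 P)
    (h' : Tendsto (fun n => eLpNorm (X' n - Y') 2 P) atTop (𝓝 0)) :
    Tendsto (fun n => ∫ ω, X n ω * X' n ω ∂P) atTop (𝓝 (∫ ω, Y ω * Y' ω ∂P)) := by
  have h1 : Tendsto (fun n => (hX n).toLp) atTop (𝓝 hY.toLp) := by
    rw [Lp.tendsto_Lp_iff_tendsto_eLpNorm'']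
    exact h
  have h2 : Tendsto (fun n => (hX' n).toLp) atTop (𝓝 hY'.toLp) := by
    rw [Lp.tendsto_Lp_iff_tendsto_eLpNorm'']
    exact h'
  have key : ∀ {f g : Ω → ℝ} (hf : MemLp f 2 P) (hg : MemLp g 2 P),
      inner ℝ hf.toLp hg.toLp = ∫ ω, f ω * g ω ∂P := by
    intro f g hf hg
    rw [L2.inner_def]
    refine integral_congr_ae ?_
    filter_upwards [hf.coeFn_toLp, hg.coeFn_toLp] with ω h1 h2
    rw [h1, h2]
    simp [mul_comm]
  simpa only [key] using h1.inner (𝕜 := ℝ) h2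

/-- The law of a limit in mean square of Gaussian vectors is Gaussian. -/
theorem hasGaussianLaw_of_tendsto
    [IsProbabilityMeasure P] {E : Type*} [NormedAddCommGroup E] [NormedSpace ℝ E]
    [MeasurableSpace E] [BorelSpace E] [SecondCountableTopology E] [CompleteSpace E]
    {X : ℕ → Ω → E} {Y : Ω → E} (hX : ∀ n, HasGaussianLaw (X n) P) (hY : MemLp Y 2 P)
    (h : ∀ l : StrongDual ℝ E, Tendsto (fun n => eLpNorm (l ∘ X n - l ∘ Y) 2 P) atTop (𝓝 0)) :
    HasGaussianLaw Y P := by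
  have hYm : AEMeasurable Y P := hY.aestronglyMeasurable.aemeasurable
  rw [hasGaussianLaw_iff_charFunDual_map_eq hYm]
  intro l
  have hXl : ∀ n, MemLp (l ∘ X n) 2 P := fun n => ((hX n).map l).memLp_two
  have hYl : MemLp (l ∘ Y) 2 P := l.comp_memLp' hY
  -- The characteristic function of `X n` converges in two ways: to that of `Y`, since `|exp(ia) -
  -- exp(ib)| ≤ |a - b|`, and to the Gaussian formula, since mean and variance converge in mean
  -- square.
  have h1 : Tendsto (fun n => charFunDual (P.map (X n)) l) atTop
      (𝓝 (charFunDual (P.map Y) l)) := by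
    simp only [charFunDual_apply]
    have hm : ∀ n, ∫ v, Complex.exp (l v * Complex.I) ∂(P.map (X n)) =
        ∫ ω, Complex.exp (l (X n ω) * Complex.I) ∂P := fun n =>
      integral_map (hX n).aemeasurable (by fun_prop)
    have hm' : ∫ v, Complex.exp (l v * Complex.I) ∂(P.map Y) =
        ∫ ω, Complex.exp (l (Y ω) * Complex.I) ∂P := integral_map hYm (by fun_prop)
    simp only [hm, hm']
    have hint : ∀ {Z : Ω → E}, AEMeasurable Z P →
        Integrable (fun ω => Complex.exp (l (Z ω) * Complex.I)) P := by
      intro Z hZ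
      refine Integrable.of_bound (C := 1) ?_ (ae_of_all _ fun ω => ?_)
      · exact AEMeasurable.aestronglyMeasurable (by fun_prop)
      · rw [Complex.norm_exp_ofReal_mul_I]
    refine tendsto_integral_of_L1' _ (hint hYm).aestronglyMeasurable
      (Eventually.of_forall fun n => hint (hX n).aemeasurable) ?_
    refine tendsto_of_tendsto_of_tendsto_of_le_of_le tendsto_const_nhds (h l) (fun _ => zero_le)
      fun n => ?_
    refine le_trans (eLpNorm_mono fun ω => ?_) (eLpNorm_le_eLpNorm_of_exponent_le
      (by norm_num) ((hXl n).sub hYl).aestronglyMeasurable)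
    have := Real.norm_exp_I_mul_ofReal_sub_one_le (x := l (X n ω) - l (Y ω))
    have h2 : Complex.exp (l (X n ω) * Complex.I) - Complex.exp (l (Y ω) * Complex.I) =
        Complex.exp (l (Y ω) * Complex.I) *
          (Complex.exp (Complex.I * (l (X n ω) - l (Y ω) : ℝ)) - 1) := by
      rw [mul_sub, ← Complex.exp_add, mul_one]
      congr 2
      push_cast
      ring
    simp only [Pi.sub_apply, Function.comp_apply]
    rw [h2, norm_mul, Complex.norm_exp_ofReal_mul_I, one_mul]
    exact this
  refine tendsto_nhds_unique h1 ?_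
  simp only [fun n => (hX n).charFunDual_map_eq l]
  have h3 := tendsto_integral_of_tendsto_eLpNorm_two hXl hYl (h l)
  have h4 := tendsto_integral_mul_of_tendsto_eLpNorm_two hXl hYl (h l) hXl hYl (h l)
  have h5 : Tendsto (fun n => Var[l ∘ X n; P]) atTop (𝓝 Var[l ∘ Y; P]) := by
    simp only [fun n => variance_eq_sub (hXl n), variance_eq_sub hYl]
    refine Tendsto.sub ?_ (h3.pow 2)
    simpa only [Pi.pow_apply, pow_two] using h4
  have c1 := (Complex.continuous_ofReal.tendsto _).comp h3
  have c2 := (Complex.continuous_ofReal.tendsto _).comp h5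
  exact (Complex.continuous_exp.tendsto _).comp ((c1.mul_const _).sub (c2.div_const _))

/-- A complex variable and a real vector that are jointly Gaussian, centered and uncorrelated are
independent. -/
theorem indepFun_of_integral_mul_eq_zero
    [IsProbabilityMeasure P] {M : ℕ} {R : Ω → ℂ} {y : Ω → Fin M → ℝ}
    (h : HasGaussianLaw (fun ω => (R ω, y ω)) P) (hR : ∫ ω, R ω ∂P = 0)
    (hRy : ∀ m, ∫ ω, R ω * y ω m ∂P = 0) : IndepFun R y P := by
  refine h.indepFun_of_covariance_strongDual fun l₁ l₂ => ?_
  have hR2 : MemLp R 2 P := h.fst.memLp_two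
  have hy2 : MemLp y 2 P := h.snd.memLp_two
  have hm2 : ∀ m, MemLp (fun ω => y ω m) 2 P := fun m =>
    (ContinuousLinearMap.proj (R := ℝ) (φ := fun _ : Fin M => ℝ) m).comp_memLp' hy2
  rw [covariance_eq_sub (l₁.comp_memLp' hR2) (l₂.comp_memLp' hy2)]
  have h1 : ∫ ω, (l₁ ∘ R) ω ∂P = 0 := by
    have := l₁.integral_comp_comm (hR2.integrable (by norm_num))
    rw [hR, map_zero] at this
    exact this
  have hi : ∀ m, Integrable (fun ω => R ω * y ω m) P := fun m => by
    have : MemLp (fun ω => (y ω m : ℂ)) 2 P := Complex.ofRealCLM.comp_memLp' (hm2 m)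
    exact hR2.integrable_mul this
  -- As `y` is real, its coordinates pass through the real-linear form `l₁`. So the complex
  -- identities `E[R y_m] = 0` control real and imaginary parts together, and no separate identity
  -- with the conjugate of `R` is needed.
  have h2 : ∀ ω, (l₁ ∘ R * l₂ ∘ y) ω = ∑ m, l₂ (Pi.single m 1) * l₁ (R ω * y ω m) := by
    intro ω
    have h3 : l₂ (y ω) = ∑ m, y ω m * l₂ (Pi.single m 1) := by
      conv_lhs => rw [pi_eq_sum_univ' (y ω)]
      simp [map_sum]
    simp only [Pi.mul_apply, Function.comp_apply, h3, Finset.mul_sum]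
    refine Finset.sum_congr rfl fun m _ => ?_
    have h4 : R ω * (y ω m : ℂ) = y ω m • R ω := by
      rw [Complex.real_smul, mul_comm]
    rw [h4, map_smul, smul_eq_mul]
    ring
  rw [h1, zero_mul, sub_zero]
  simp only [h2]
  rw [integral_finsetSum _ fun m _ => (l₁.integrable_comp (hi m)).const_mul _]
  refine Finset.sum_eq_zero fun m _ => ?_
  rw [integral_const_mul, l₁.integral_comp_comm (hi m), hRy, map_zero, mul_zero]

/-- Pythagoras: a centered variable is orthogonal to every function of an independent one. -/
theorem lintegral_enorm_sub_sq {β : Type*} [MeasurableSpace β] {R : Ω → ℂ} {y : Ω → β}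
    (hR2 : MemLp R 2 P) (hR : ∫ ω, R ω ∂P = 0) (hy : AEMeasurable y P) (hind : IndepFun R y P)
    {g : β → ℂ} (hg : Measurable g) :
    ∫⁻ ω, ‖R ω - g (y ω)‖ₑ ^ 2 ∂P = ∫⁻ ω, ‖R ω‖ₑ ^ 2 ∂P + ∫⁻ ω, ‖g (y ω)‖ₑ ^ 2 ∂P := by
  have hnorm : ∀ Z : Ω → ℂ, ∫⁻ ω, ‖Z ω‖ₑ ^ 2 ∂P = eLpNorm Z 2 P ^ 2 := by
    intro Z
    have := eLpNorm_nnreal_pow_eq_lintegral (f := Z) (μ := P) (p := 2) (by norm_num)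
    simpa using this.symm
  have hgm : AEStronglyMeasurable (fun ω => g (y ω)) P :=
    (hg.comp_aemeasurable hy).aestronglyMeasurable
  by_cases hfin : MemLp (fun ω => g (y ω)) 2 P
  · have hsub : MemLp (fun ω => R ω - g (y ω)) 2 P := hR2.sub hfin
    have hconv : ∀ {Z : Ω → ℂ}, MemLp Z 2 P →
        ∫⁻ ω, ‖Z ω‖ₑ ^ 2 ∂P = ENNReal.ofReal (∫ ω, ‖Z ω‖ ^ 2 ∂P) := by
      intro Z hZ
      rw [ofReal_integral_eq_lintegral_ofReal (hZ.integrable_norm_pow (by norm_num))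
        (ae_of_all _ fun _ => by positivity)]
      simp only [← ofReal_norm, ENNReal.ofReal_pow (norm_nonneg _)]
    have hR2i : Integrable (fun ω => ‖R ω‖ ^ 2) P := hR2.integrable_norm_pow (by norm_num)
    have hg2i : Integrable (fun ω => ‖g (y ω)‖ ^ 2) P := hfin.integrable_norm_pow (by norm_num)
    rw [hconv hsub, hconv hR2, hconv hfin,
      ← ENNReal.ofReal_add (integral_nonneg fun _ => by positivity)
        (integral_nonneg fun _ => by positivity), ← integral_add hR2i hg2i]
    congr 1
    have hci : Integrable (fun ω => R ω * (starRingEnd ℂ) (g (y ω))) P := by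
      have : MemLp (fun ω => (starRingEnd ℂ) (g (y ω))) 2 P :=
        (Complex.conjCLE : ℂ →L[ℝ] ℂ).comp_memLp' hfin
      exact hR2.integrable_mul this
    have hcross : ∫ ω, R ω * (starRingEnd ℂ) (g (y ω)) ∂P = 0 := by
      have h1 : IndepFun R (fun ω => (starRingEnd ℂ) (g (y ω))) P :=
        hind.comp measurable_id (Complex.continuous_conj.measurable.comp hg)
      have h2 := h1.integral_fun_mul_eq_mul_integral hR2.aestronglyMeasurable
        (Complex.continuous_conj.comp_aestronglyMeasurable hgm)
      rw [h2, hR, zero_mul]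
    have hre : ∫ ω, (R ω * (starRingEnd ℂ) (g (y ω))).re ∂P = 0 := by
      have := Complex.reCLM.integral_comp_comm hci
      rw [hcross] at this
      simpa using this
    have hpt : ∀ ω, ‖R ω - g (y ω)‖ ^ 2 = (‖R ω‖ ^ 2 + ‖g (y ω)‖ ^ 2) -
        2 * (R ω * (starRingEnd ℂ) (g (y ω))).re := fun ω => by
      simp only [← Complex.normSq_eq_norm_sq]
      rw [Complex.normSq_sub]
    simp only [hpt]
    have hrei : Integrable (fun ω => 2 * (R ω * (starRingEnd ℂ) (g (y ω))).re) P :=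
      (Complex.reCLM.integrable_comp hci).const_mul 2
    have hadd : Integrable (fun ω => ‖R ω‖ ^ 2 + ‖g (y ω)‖ ^ 2) P := hR2i.add hg2i
    rw [integral_sub hadd hrei, integral_const_mul, hre, mul_zero, sub_zero]
  -- If `g(y)` is not square-integrable, neither is `R - g(y)`, because `R` is; both sides are
  -- infinite.
  · have h1 : eLpNorm (fun ω => g (y ω)) 2 P = ∞ := by
      by_contra hne
      exact hfin ⟨hgm, lt_top_iff_ne_top.2 hne⟩
    have h2 : eLpNorm (fun ω => R ω - g (y ω)) 2 P = ∞ := by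
      by_contra hne
      have h3 : MemLp (fun ω => R ω - g (y ω)) 2 P :=
        ⟨hR2.aestronglyMeasurable.sub hgm, lt_top_iff_ne_top.2 hne⟩
      refine hfin ?_
      have := hR2.sub h3
      refine this.congr_norm hgm (ae_of_all _ fun ω => by simp)
    rw [hnorm, hnorm, hnorm, h1, h2]
    simp

end Probability

/-! ### Fourier coefficients of a Gaussian bridge -/

section WhiteNoise

theorem conjTest_apply (φ : PerTest) (t : UnitAddCircle) :
    (conjTest φ).1 t = (starRingEnd ℂ) (φ.1 t) := rfl

theorem add_test_apply (φ ψ : PerTest) (t : UnitAddCircle) :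
    (φ + ψ).1 t = φ.1 t + ψ.1 t := rfl

theorem smul_test_apply (c : ℂ) (φ : PerTest) (t : UnitAddCircle) :
    (c • φ).1 t = c * φ.1 t := rfl

/-- The real part of a test function. -/
def reTest (φ : PerTest) : PerTest := (1 / 2 : ℂ) • (φ + conjTest φ)

/-- The imaginary part of a test function. -/
def imTest (φ : PerTest) : PerTest :=
  (-Complex.I / 2) • (φ + (-1 : ℂ) • conjTest φ)

theorem reTest_apply (φ : PerTest) (t : UnitAddCircle) : (reTest φ).1 t = ((φ.1 t).re : ℂ) := by
  rw [reTest, smul_test_apply, add_test_apply, conjTest_apply, Complex.add_conj]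
  push_cast
  ring

theorem imTest_apply (φ : PerTest) (t : UnitAddCircle) : (imTest φ).1 t = ((φ.1 t).im : ℂ) := by
  rw [imTest, smul_test_apply, add_test_apply, smul_test_apply, conjTest_apply, neg_one_mul,
    ← sub_eq_add_neg, Complex.sub_conj]
  push_cast
  linear_combination (-(φ.1 t).im : ℂ) * Complex.I_sq

theorem conjTest_reTest (φ : PerTest) : conjTest (reTest φ) = reTest φ :=
  Subtype.ext (funext fun t => by
    rw [conjTest_apply, reTest_apply, Complex.conj_ofReal])

theorem conjTest_imTest (φ : PerTest) : conjTest (imTest φ) = imTest φ :=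
  Subtype.ext (funext fun t => by
    rw [conjTest_apply, imTest_apply, Complex.conj_ofReal])

theorem reTest_add_imTest (φ : PerTest) : φ = reTest φ + Complex.I • imTest φ :=
  Subtype.ext (funext fun t => by
    rw [add_test_apply, smul_test_apply, reTest_apply, imTest_apply, mul_comm, Complex.re_add_im])

variable {Ω : Type*} [MeasurableSpace Ω] {P : Measure Ω} {w : Ω → PerDist}

/-- The axioms of the noise concern only real parts on real test functions. Almost sure realness
makes these the full values, and linearity reaches complex test functions. -/
theorem IsWhiteNoise.ae_eq (hw : IsWhiteNoise P w) (φ : PerTest) :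
    ∀ᵐ ω ∂P, (w ω).1 φ =
      (((w ω).1 (reTest φ)).re : ℂ) + Complex.I * (((w ω).1 (imTest φ)).re : ℂ) := by
  filter_upwards [hw.real] with ω h
  have key : ∀ ψ, conjTest ψ = ψ → (((w ω).1 ψ).re : ℂ) = (w ω).1 ψ := fun ψ hψ => by
    have := h ψ
    rw [hψ] at this
    exact Complex.conj_eq_iff_re.1 this.symm
  rw [key _ (conjTest_reTest φ), key _ (conjTest_imTest φ), ← smul_eq_mul, ← map_smul, ← map_add,
    ← reTest_add_imTest]

theorem IsWhiteNoise.memLp_re (hw : IsWhiteNoise P w) {φ : PerTest} (hφ : conjTest φ = φ) :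
    MemLp (fun ω => ((w ω).1 φ).re) 2 P :=
  (hw.gaussian.hasGaussianLaw_eval ⟨φ, hφ⟩).memLp_two

theorem IsWhiteNoise.integral_eq_zero
    [IsProbabilityMeasure P] (hw : IsWhiteNoise P w) (φ : PerTest) :
    ∫ ω, (w ω).1 φ ∂P = 0 := by
  have h1 := (hw.memLp_re (conjTest_reTest φ)).integrable (by norm_num)
  have h2 := (hw.memLp_re (conjTest_imTest φ)).integrable (by norm_num)
  rw [integral_congr_ae (hw.ae_eq φ), integral_add h1.ofReal (h2.ofReal.const_mul _),
    integral_const_mul, integral_complex_ofReal, integral_complex_ofReal,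
    hw.centered _ (conjTest_reTest φ), hw.centered _ (conjTest_imTest φ)]
  simp

theorem integral_add_I_mul_mul_conj {α : Type*} [MeasurableSpace α] {μ : Measure α}
    {A B C D : α → ℝ}
    (h1 : Integrable (fun a => A a * C a) μ) (h2 : Integrable (fun a => B a * D a) μ)
    (h3 : Integrable (fun a => B a * C a) μ) (h4 : Integrable (fun a => A a * D a) μ) :
    ∫ a, ((A a : ℂ) + Complex.I * B a) * (starRingEnd ℂ) ((C a : ℂ) + Complex.I * D a) ∂μ =
      ((∫ a, A a * C a ∂μ : ℝ) + (∫ a, B a * D a ∂μ : ℝ)) +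
        Complex.I * ((∫ a, B a * C a ∂μ : ℝ) - (∫ a, A a * D a ∂μ : ℝ)) := by
  simp only [← integral_complex_ofReal]
  rw [← integral_add h1.ofReal h2.ofReal, ← integral_sub h3.ofReal h4.ofReal,
    ← integral_const_mul, ← integral_add (h1.ofReal.add h2.ofReal)
      ((h3.ofReal.sub h4.ofReal).const_mul _)]
  refine integral_congr_ae (ae_of_all _ fun a => ?_)
  simp only [map_add, map_mul, Complex.conj_ofReal, Complex.conj_I, Complex.ofReal_mul]
  linear_combination (-(B a : ℂ) * D a) * Complex.I_sq

/-- The same expansion into four real products applies in probability space and on the circle, where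
the covariance axiom matches the products one by one. -/
theorem IsWhiteNoise.integral_mul_conj (hw : IsWhiteNoise P w) (φ ψ : PerTest) :
    ∫ ω, (w ω).1 φ * (starRingEnd ℂ) ((w ω).1 ψ) ∂P =
      ∫ t, φ.1 t * (starRingEnd ℂ) (ψ.1 t) ∂haar := by
  have hm : ∀ φ, MemLp (fun ω => ((w ω).1 (reTest φ)).re) 2 P := fun φ =>
    hw.memLp_re (conjTest_reTest φ)
  have hm' : ∀ φ, MemLp (fun ω => ((w ω).1 (imTest φ)).re) 2 P := fun φ =>
    hw.memLp_re (conjTest_imTest φ)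
  have hL : ∫ ω, (w ω).1 φ * (starRingEnd ℂ) ((w ω).1 ψ) ∂P = _ :=
    (integral_congr_ae (by
      filter_upwards [hw.ae_eq φ, hw.ae_eq ψ] with ω h1 h2
      rw [h1, h2])).trans (integral_add_I_mul_mul_conj ((hm φ).integrable_mul (hm ψ))
        ((hm' φ).integrable_mul (hm' ψ))
        ((hm' φ).integrable_mul (hm ψ)) ((hm φ).integrable_mul (hm' ψ)))
  have hcont : ∀ {f : UnitAddCircle → ℝ}, Continuous f → Integrable f haar := fun hf =>
    hf.integrable_of_hasCompactSupport (HasCompactSupport.of_compactSpace _)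
  have hre : ∀ φ : PerTest, Continuous fun t => (φ.1 t).re := fun φ =>
    Complex.continuous_re.comp (PerTest.continuous φ)
  have him : ∀ φ : PerTest, Continuous fun t => (φ.1 t).im := fun φ =>
    Complex.continuous_im.comp (PerTest.continuous φ)
  have hR : ∫ t, φ.1 t * (starRingEnd ℂ) (ψ.1 t) ∂haar = _ :=
    (integral_congr_ae (ae_of_all _ fun t => by
      rw [mul_comm Complex.I, mul_comm Complex.I, Complex.re_add_im, Complex.re_add_im])).trans
      (integral_add_I_mul_mul_conj (hcont ((hre φ).mul (hre ψ))) (hcont ((him φ).mul (him ψ)))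
        (hcont ((him φ).mul (hre ψ))) (hcont ((hre φ).mul (him ψ))))
  rw [hL, hR, hw.covariance _ _ (conjTest_reTest φ) (conjTest_reTest ψ),
    hw.covariance _ _ (conjTest_imTest φ) (conjTest_imTest ψ),
    hw.covariance _ _ (conjTest_imTest φ) (conjTest_reTest ψ),
    hw.covariance _ _ (conjTest_reTest φ) (conjTest_imTest ψ)]
  simp only [reTest_apply, imTest_apply, Complex.ofReal_re]

theorem integral_e_mul_conj (j k : ℤ) :
    ∫ t, (e (-j)).1 t * (starRingEnd ℂ) ((e (-k)).1 t) ∂haar = if j = k then 1 else 0 := by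
  have h : ∫ t, (e (-j)).1 t * (starRingEnd ℂ) ((e (-k)).1 t) ∂haar =
      fourierCoeff (fourier (T := 1) k) j := by
    refine integral_congr_ae (ae_of_all _ fun t => ?_)
    change (fourier (-j) t : ℂ) * (starRingEnd ℂ) (fourier (-k) t) = fourier (-j) t • fourier k t
    rw [← fourier_neg, neg_neg, smul_eq_mul]
  rw [h, fourierCoeff_fourier, Pi.single_apply]

end WhiteNoise

/-! ### Covariance and joint Gaussianity of the coefficients of the bridge. -/

section Bridge

variable {Ω : Type*} [MeasurableSpace Ω] {P : Measure Ω}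
  {L : LSIOperator} {γ : ℝ} {s : Ω → PerDist}

theorem IsGaussianBridge.exists_whiteNoise (hγ : 0 < γ) (hs : IsGaussianBridge P L γ s) :
    ∃ w : Ω → PerDist, IsWhiteNoise P w ∧
      ∀ k, ∀ᵐ ω ∂P, fc (s ω) k = (L.freqReg γ k)⁻¹ * (w ω).1 (e (-k)) := by
  obtain ⟨w, hw, h⟩ := hs
  refine ⟨w, hw, fun k => ?_⟩
  filter_upwards [h] with ω hω
  have := hω k
  rw [eq_inv_mul_iff_mul_eq₀ (L.freqReg_ne_zero hγ k), this]
  rfl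

/-- Each coefficient is almost surely a fixed real-linear function of the noise at the real and
imaginary parts of `e (-k)`. -/
theorem IsGaussianBridge.isGaussianProcess_fc (hγ : 0 < γ) (hs : IsGaussianBridge P L γ s) :
    IsGaussianProcess (fun (k : ℤ) ω => fc (s ω) k) P := by
  classical
  obtain ⟨w, hw, h⟩ := hs.exists_whiteNoise hγ
  have h1 : IsGaussianProcess (fun (k : ℤ) ω => (L.freqReg γ k)⁻¹ *
      ((((w ω).1 (reTest (e (-k)))).re : ℂ) +
        Complex.I * (((w ω).1 (imTest (e (-k)))).re : ℂ))) P := by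
    refine hw.gaussian.of_isGaussianProcess fun k => ?_
    let a : {φ : PerTest // conjTest φ = φ} := ⟨reTest (e (-k)), conjTest_reTest _⟩
    let b : {φ : PerTest // conjTest φ = φ} := ⟨imTest (e (-k)), conjTest_imTest _⟩
    let I : Finset {φ : PerTest // conjTest φ = φ} := {a, b}
    let pa : (I → ℝ) →L[ℝ] ℝ := ContinuousLinearMap.proj ⟨a, by simp [I]⟩
    let pb : (I → ℝ) →L[ℝ] ℝ := ContinuousLinearMap.proj ⟨b, by simp [I]⟩
    let mulC (c : ℂ) : ℂ →L[ℝ] ℂ := ContinuousLinearMap.mul ℝ ℂ c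
    refine ⟨I, (mulC (L.freqReg γ k)⁻¹).comp ((Complex.ofRealCLM.comp pa) +
      (mulC Complex.I).comp (Complex.ofRealCLM.comp pb)), fun ω => ?_⟩
    rfl
  refine h1.congr fun k => ?_
  filter_upwards [h k, hw.ae_eq (e (-k))] with ω h2 h3
  rw [h2, h3]

theorem IsGaussianBridge.integral_fc
    [IsProbabilityMeasure P] (hγ : 0 < γ) (hs : IsGaussianBridge P L γ s) (k : ℤ) :
    ∫ ω, fc (s ω) k ∂P = 0 := by
  obtain ⟨w, hw, h⟩ := hs.exists_whiteNoise hγ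
  rw [integral_congr_ae (h k), integral_const_mul, hw.integral_eq_zero, mul_zero]

theorem IsGaussianBridge.integral_fc_mul_conj (hγ : 0 < γ) (hs : IsGaussianBridge P L γ s)
    (j k : ℤ) : ∫ ω, fc (s ω) j * (starRingEnd ℂ) (fc (s ω) k) ∂P =
      if j = k then (L.kernelCoeff γ k : ℂ) else 0 := by
  obtain ⟨w, hw, h⟩ := hs.exists_whiteNoise hγ
  have h1 : ∀ᵐ ω ∂P, fc (s ω) j * (starRingEnd ℂ) (fc (s ω) k) =
      ((L.freqReg γ j)⁻¹ * (starRingEnd ℂ) (L.freqReg γ k)⁻¹) *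
        ((w ω).1 (e (-j)) * (starRingEnd ℂ) ((w ω).1 (e (-k)))) := by
    filter_upwards [h j, h k] with ω hj hk
    rw [hj, hk, map_mul]
    ring
  rw [integral_congr_ae h1, integral_const_mul, hw.integral_mul_conj, integral_e_mul_conj]
  split_ifs with hjk
  · subst hjk
    rw [mul_one, map_inv₀, ← mul_inv, Complex.mul_conj, Complex.normSq_eq_norm_sq,
      L.kernelCoeff_eq]
    push_cast
    rw [one_div]
  · rw [mul_zero]

end Bridge

/-! ### Measurements of a Gaussian bridge -/

section Measurement

variable {Ω : Type*} [MeasurableSpace Ω] {P : Measure Ω}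
  {L : LSIOperator} {γ : ℝ} {s : Ω → PerDist}

/-- The partial sums of the series of a measurement. -/
def partialMeasurement (s : Ω → PerDist) (ν : PerDist) (N : ℕ) (ω : Ω) : ℂ :=
  ∑ k ∈ Finset.Icc (-(N : ℤ)) N, fc (s ω) k * ν.1 (e k)

theorem IsGaussianBridge.memLp_fc (hγ : 0 < γ) (hs : IsGaussianBridge P L γ s) (k : ℤ) :
    MemLp (fun ω => fc (s ω) k) 2 P :=
  ((hs.isGaussianProcess_fc hγ).hasGaussianLaw_eval k).memLp_two

theorem IsGaussianBridge.memLp_partialMeasurement (hγ : 0 < γ) (hs : IsGaussianBridge P L γ s)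
    (ν : PerDist) (N : ℕ) : MemLp (partialMeasurement s ν N) 2 P :=
  memLp_finsetSum _ fun k _ => (hs.memLp_fc hγ k).mul_const _

theorem IsMeasurement.memLp_ofReal {ν : PerDist} {x : Ω → ℝ} (hx : IsMeasurement P s ν x) :
    MemLp (fun ω => (x ω : ℂ)) 2 P :=
  Complex.ofRealCLM.comp_memLp' hx.1

theorem integral_mul_conj_eq_inner {f g : Ω → ℂ} (hf : MemLp f 2 P) (hg : MemLp g 2 P) :
    ∫ ω, f ω * (starRingEnd ℂ) (g ω) ∂P = inner ℂ hg.toLp hf.toLp := by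
  rw [L2.inner_def]
  refine integral_congr_ae ?_
  filter_upwards [hf.coeFn_toLp, hg.coeFn_toLp] with ω h1 h2
  rw [h1, h2, RCLike.inner_apply]

/-- Continuity of the inner product of `L²(P)`. All the moments of measurements below come from this
limit with a suitable `Z`. -/
theorem IsMeasurement.tendsto_integral_mul_conj (hγ : 0 < γ) (hs : IsGaussianBridge P L γ s)
    {ν : PerDist} {x : Ω → ℝ} (hx : IsMeasurement P s ν x) {Z : Ω → ℂ} (hZ : MemLp Z 2 P) :
    Tendsto (fun N : ℕ => ∑ k ∈ Finset.Icc (-(N : ℤ)) N,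
      ν.1 (e k) * ∫ ω, fc (s ω) k * (starRingEnd ℂ) (Z ω) ∂P) atTop
      (𝓝 (∫ ω, x ω * (starRingEnd ℂ) (Z ω) ∂P)) := by
  have h1 : Tendsto (fun N => (hs.memLp_partialMeasurement hγ ν N).toLp) atTop
      (𝓝 hx.memLp_ofReal.toLp) := by
    rw [Lp.tendsto_Lp_iff_tendsto_eLpNorm'']
    exact hx.2
  have h2 := (tendsto_const_nhds (x := hZ.toLp)).inner (𝕜 := ℂ) h1
  simp only [← integral_mul_conj_eq_inner] at h2
  refine h2.congr fun N => ?_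
  simp only [partialMeasurement, Finset.sum_mul]
  have hZ' : MemLp (fun ω => (starRingEnd ℂ) (Z ω)) 2 P :=
    (Complex.conjCLE : ℂ →L[ℝ] ℂ).comp_memLp' hZ
  have hint : ∀ k, Integrable (fun ω => fc (s ω) k * ν.1 (e k) * (starRingEnd ℂ) (Z ω)) P :=
    fun k => ((hs.memLp_fc hγ k).mul_const _).integrable_mul hZ'
  rw [integral_finsetSum _ fun k _ => hint k]
  refine Finset.sum_congr rfl fun k _ => ?_
  rw [← integral_const_mul]
  refine integral_congr_ae (ae_of_all _ fun ω => ?_)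
  ring

theorem IsMeasurement.integral_eq_zero
    [IsProbabilityMeasure P] (hγ : 0 < γ) (hs : IsGaussianBridge P L γ s)
    {ν : PerDist} {x : Ω → ℝ} (hx : IsMeasurement P s ν x) : ∫ ω, (x ω : ℂ) ∂P = 0 := by
  have h := hx.tendsto_integral_mul_conj hγ hs (Z := fun _ => 1) (memLp_const 1)
  simp only [map_one, mul_one, hs.integral_fc hγ, mul_zero, Finset.sum_const_zero] at h
  exact (tendsto_nhds_unique h tendsto_const_nhds)

theorem IsMeasurement.integral_mul_conj_fc (hγ : 0 < γ) (hs : IsGaussianBridge P L γ s)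
    {ν : PerDist} {x : Ω → ℝ} (hx : IsMeasurement P s ν x) (k : ℤ) :
    ∫ ω, x ω * (starRingEnd ℂ) (fc (s ω) k) ∂P = L.kernelCoeff γ k * ν.1 (e k) := by
  refine tendsto_nhds_unique (hx.tendsto_integral_mul_conj hγ hs (hs.memLp_fc hγ k)) ?_
  refine tendsto_const_nhds.congr' ?_
  -- Distinct coefficients are uncorrelated, so the partial sums are constant once `N` reaches
  -- `|k|`.
  filter_upwards [eventually_ge_atTop k.natAbs] with N hN
  simp only [hs.integral_fc_mul_conj hγ, mul_ite, mul_zero, Finset.sum_ite_eq']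
  rw [if_pos (Finset.mem_Icc.2 (by omega)), mul_comm]

theorem IsMeasurement.integral_fc_mul (hγ : 0 < γ) (hs : IsGaussianBridge P L γ s)
    {ν : PerDist} {x : Ω → ℝ} (hx : IsMeasurement P s ν x) (k : ℤ) :
    ∫ ω, fc (s ω) k * x ω ∂P = L.kernelCoeff γ k * (starRingEnd ℂ) (ν.1 (e k)) := by
  have h := congrArg (starRingEnd ℂ) (hx.integral_mul_conj_fc hγ hs k)
  rw [← integral_conj, map_mul, Complex.conj_ofReal] at h
  rw [← h]
  refine integral_congr_ae (ae_of_all _ fun ω => ?_)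
  simp only [map_mul, Complex.conj_ofReal, Complex.conj_conj]
  ring

theorem tendsto_Icc_neg_atTop :
    Tendsto (fun N : ℕ => Finset.Icc (-(N : ℤ)) N) atTop atTop := by
  refine tendsto_atTop_finset_of_monotone (fun a b hab => ?_) fun k => ⟨k.natAbs, ?_⟩
  · exact Finset.Icc_subset_Icc (by omega) (by omega)
  · exact Finset.mem_Icc.2 (by omega)

/-- Both sides are `∑ ĥ[k] ν(e_k) conj (μ(e_k))`. The series converges absolutely, so the symmetric
partial sums reach its unconditional value. -/
theorem IsMeasurement.integral_mul (hγ : 0 < γ) (hL : L.IsRKHS γ)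
    (hs : IsGaussianBridge P L γ s) {ν μ : PerDist} (hν : L.MemDual γ ν) (hμ : L.MemDual γ μ)
    (hμr : IsRealDist μ) {x z : Ω → ℝ} (hx : IsMeasurement P s ν x) (hz : IsMeasurement P s μ z) :
    ∫ ω, (x ω : ℂ) * z ω ∂P = bracket ν (conv (L.kernel γ) μ) := by
  have h := hx.tendsto_integral_mul_conj hγ hs hz.memLp_ofReal
  simp only [Complex.conj_ofReal, hz.integral_fc_mul hγ hs] at h
  refine tendsto_nhds_unique h ?_
  have hsum := (L.summable_kernelCoeff_mul_mul hγ hν hμ).hasSum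
  rw [bracket, L.bracketTerm_conv_kernel hγ hL ν hμ hμr]
  refine (hsum.comp tendsto_Icc_neg_atTop).congr fun N => Finset.sum_congr rfl fun k _ => ?_
  ring

variable {M : ℕ} {ν : Fin M → PerDist} {x ε : Fin M → Ω → ℝ}

/-- Fourier coefficients, measurements and noise are jointly Gaussian. -/
theorem IsGaussianBridge.hasGaussianLaw_joint
    [IsProbabilityMeasure P] (hγ : 0 < γ) (hs : IsGaussianBridge P L γ s)
    (hx : ∀ m, IsMeasurement P s (ν m) (x m))
    (hε : HasGaussianLaw (fun ω m => ε m ω) P)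
    (hεs : IndepFun (fun ω (φ : PerTest) => (s ω).1 φ) (fun ω m => ε m ω) P) (k : ℤ) :
    HasGaussianLaw (fun ω => ((fc (s ω) k, fun m => x m ω), fun m => ε m ω)) P := by
  classical
  -- Truncated measurements involve finitely many coefficients, hence are Gaussian jointly with
  -- `ŝ[k]`. Taking real parts is harmless in the limit, since `x m` is real.
  let X : ℕ → Ω → (ℂ × (Fin M → ℝ)) × (Fin M → ℝ) := fun N ω =>
    ((fc (s ω) k, fun m => (partialMeasurement s (ν m) N ω).re), fun m => ε m ω)
  have hX : ∀ N, HasGaussianLaw (X N) P := by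
    intro N
    refine IndepFun.hasGaussianLaw ?_ hε ?_
    · let I : Finset ℤ := insert k (Finset.Icc (-(N : ℤ)) N)
      let B : Fin M → (I → ℂ) →L[ℝ] ℂ := fun m => ∑ j ∈ (Finset.Icc (-(N : ℤ)) N).attach,
        (ContinuousLinearMap.mul ℝ ℂ ((ν m).1 (e j))).comp
          (ContinuousLinearMap.proj (⟨j, Finset.mem_insert_of_mem j.2⟩ : I))
      have hB : ∀ m v, B m v = ∑ j ∈ (Finset.Icc (-(N : ℤ)) N).attach,
          (ν m).1 (e j) * v ⟨j, Finset.mem_insert_of_mem j.2⟩ := fun m v => by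
        simp only [B, sum_apply]
        rfl
      let A : (I → ℂ) →L[ℝ] ℂ × (Fin M → ℝ) :=
        (ContinuousLinearMap.proj (⟨k, Finset.mem_insert_self _ _⟩ : I)).prod
          (ContinuousLinearMap.pi fun m => Complex.reCLM.comp (B m))
      have h1 := ((hs.isGaussianProcess_fc hγ).hasGaussianLaw I).map A
      refine h1.congr (ae_of_all _ fun ω => ?_)
      refine Prod.ext rfl (funext fun m => ?_)
      change (B m _).re = (partialMeasurement s (ν m) N ω).re
      rw [partialMeasurement, ← Finset.sum_attach, hB]
      congr 1
      exact Finset.sum_congr rfl fun j _ => mul_comm _ _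
    -- The first block is a measurable function of finitely many values of `s`, so it inherits
    -- independence from the noise.
    · refine hεs.comp (φ := fun f : PerTest → ℂ => ((f (e (-k)), fun m =>
        (∑ j ∈ Finset.Icc (-(N : ℤ)) N, f (e (-j)) * (ν m).1 (e j)).re) : ℂ × (Fin M → ℝ)))
        (ψ := id) ?_ measurable_id
      refine (measurable_pi_apply _).prodMk (measurable_pi_lambda _ fun m => ?_)
      refine Complex.measurable_re.comp (Finset.measurable_fun_sum _ fun j _ => ?_)
      exact (measurable_pi_apply _).mul_const _
  refine hasGaussianLaw_of_tendsto hX ?_ fun l => ?_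
  · have h1 : MemLp (fun ω => fc (s ω) k) 2 P := hs.memLp_fc hγ k
    have h2 : MemLp (fun ω m => x m ω) 2 P := MemLp.of_eval fun m => (hx m).1
    exact MemLp.of_fst_snd ⟨MemLp.of_fst_snd ⟨h1, h2⟩, hε.memLp_two⟩
  · let c : Fin M → ℝ := fun m => l ((0, Pi.single m 1), 0)
    -- Only the measurement block depends on `N`, so `l` sees the truncation errors alone, weighted
    -- by its coefficients there.
    have hdiff : ∀ N, (l ∘ X N - l ∘ fun ω => ((fc (s ω) k, fun m => x m ω), fun m => ε m ω)) =
        ∑ m, c m • fun ω => (partialMeasurement s (ν m) N ω - x m ω).re := by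
      intro N
      funext ω
      simp only [Pi.sub_apply, Function.comp_apply, ← map_sub, Finset.sum_apply, Pi.smul_apply, X,
        Prod.mk_sub_mk, sub_self]
      let B : (Fin M → ℝ) →ₗ[ℝ] ℝ := l.toLinearMap.comp
        ((LinearMap.inl ℝ (ℂ × (Fin M → ℝ)) (Fin M → ℝ)).comp (LinearMap.inr ℝ ℂ (Fin M → ℝ)))
      have hB := LinearMap.pi_apply_eq_sum_univ B
        ((fun m => (partialMeasurement s (ν m) N ω).re) - fun m => x m ω)
      refine hB.trans (Finset.sum_congr rfl fun m _ => ?_)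
      have hc : B (fun j => if m = j then 1 else 0) = c m := by
        have : (fun j => if m = j then (1 : ℝ) else 0) = Pi.single m 1 := by
          funext j
          simp [Pi.single_apply, eq_comm]
        rw [this]
        rfl
      rw [hc, smul_eq_mul, smul_eq_mul, mul_comm]
      simp
    have hlim : Tendsto (fun N => ∑ m, ‖c m‖ₑ *
        eLpNorm (fun ω => partialMeasurement s (ν m) N ω - x m ω) 2 P) atTop (𝓝 0) := by
      have : Tendsto (fun N => ∑ m, ‖c m‖ₑ *
          eLpNorm (fun ω => partialMeasurement s (ν m) N ω - x m ω) 2 P) atTop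
          (𝓝 (∑ m, ‖c m‖ₑ * 0)) :=
        tendsto_finsetSum _ fun m _ => ENNReal.Tendsto.const_mul (hx m).2 (Or.inr enorm_ne_top)
      simpa using this
    refine tendsto_of_tendsto_of_tendsto_of_le_of_le tendsto_const_nhds hlim (fun _ => zero_le)
      fun N => ?_
    have hm : ∀ m, MemLp (fun ω => partialMeasurement s (ν m) N ω - x m ω) 2 P := fun m =>
      (hs.memLp_partialMeasurement hγ (ν m) N).sub (hx m).memLp_ofReal
    simp only [hdiff]
    refine (eLpNorm_sum_le (fun m _ => ?_) (by norm_num)).trans (Finset.sum_le_sum fun m _ => ?_)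
    · exact ((Complex.reCLM.comp_memLp' (hm m)).const_smul (c m)).aestronglyMeasurable
    · rw [eLpNorm_const_smul]
      gcongr
      exact eLpNorm_mono fun ω => Complex.abs_re_le_norm _

theorem IsMeasurement.integral_mul_of_indepFun
    [IsProbabilityMeasure P] (hγ : 0 < γ) (hs : IsGaussianBridge P L γ s)
    {ν : PerDist} {x : Ω → ℝ} (hx : IsMeasurement P s ν x) {η : Ω → ℝ} (hη : MemLp η 2 P)
    (hηs : IndepFun (fun ω (φ : PerTest) => (s ω).1 φ) η P) : ∫ ω, (x ω : ℂ) * η ω ∂P = 0 := by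
  have h := hx.tendsto_integral_mul_conj hγ hs (Z := fun ω => (η ω : ℂ))
    (Complex.ofRealCLM.comp_memLp' hη)
  have h0 : ∀ k, ∫ ω, fc (s ω) k * η ω ∂P = 0 := fun k => by
    have hi : IndepFun (fun ω => fc (s ω) k) (fun ω => (η ω : ℂ)) P :=
      hηs.comp (φ := fun f : PerTest → ℂ => f (e (-k))) (ψ := fun r : ℝ => (r : ℂ))
        (measurable_pi_apply _) Complex.measurable_ofReal
    rw [hi.integral_fun_mul_eq_mul_integral (hs.memLp_fc hγ k).aestronglyMeasurable
      (Complex.continuous_ofReal.comp_aestronglyMeasurable hη.aestronglyMeasurable),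
      hs.integral_fc hγ, zero_mul]
  simp only [Complex.conj_ofReal, h0, mul_zero, Finset.sum_const_zero] at h
  exact tendsto_nhds_unique h tendsto_const_nhds

end Measurement

/-! ### The mean-square error -/

section Error

variable {Ω : Type*} [MeasurableSpace Ω] {P : Measure Ω} {s : Ω → PerDist} {M : ℕ}

theorem measurable_fourierCoeff {F : (Fin M → ℝ) → L2} (hF : StronglyMeasurable F) (k : ℤ) :
    Measurable fun v => fourierCoeff (F v) k := by
  have h : (fun v => fourierCoeff (F v) k) = fun v => inner ℂ (fourierLp (T := 1) 2 k) (F v) := by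
    funext v
    rw [← fourierBasis_repr, HilbertBasis.repr_apply_apply, coe_fourierBasis]
  rw [h]
  exact (stronglyMeasurable_const.inner hF).measurable

/-- Parseval pointwise in `ω`, then Tonelli. -/
theorem mse_eq_tsum (hs : ∀ k, AEMeasurable (fun ω => fc (s ω) k) P) {y : Fin M → Ω → ℝ}
    (hy : AEMeasurable (fun ω m => y m ω) P) {F : (Fin M → ℝ) → L2} (hF : StronglyMeasurable F) :
    mse P s y F = ∑' k, ∫⁻ ω, ‖fc (s ω) k - fourierCoeff (F fun m => y m ω) k‖ₑ ^ 2 ∂P := by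
  unfold mse
  simp only [l2DistSq_eq_tsum]
  refine lintegral_tsum fun k => ?_
  have := (measurable_fourierCoeff hF k).comp_aemeasurable hy
  exact ((hs k).sub this).enorm.pow_const 2

theorem mse_congr {y z : Fin M → Ω → ℝ} (h : ∀ᵐ ω ∂P, (fun m => y m ω) = fun m => z m ω)
    (F : (Fin M → ℝ) → L2) : mse P s y F = mse P s z F := by
  refine lintegral_congr_ae ?_
  filter_upwards [h] with ω hω
  rw [hω]

/-- If the residuals of the estimator `S` are centered and independent of the data, the error of
any estimator is the error of `S` plus its distance to `S`. -/
theorem mse_eq_add (hs : ∀ k, MemLp (fun ω => fc (s ω) k) 2 P) {y : Fin M → Ω → ℝ}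
    (hy : MemLp (fun ω m => y m ω) 2 P) {S : (Fin M → ℝ) → L2} (hS : StronglyMeasurable S)
    {B : ℤ → Fin M → ℂ} (hSB : ∀ v k, fourierCoeff (S v) k = ∑ n, B k n * v n)
    (hR0 : ∀ k, ∫ ω, (fc (s ω) k - ∑ n, B k n * y n ω) ∂P = 0)
    (hind : ∀ k, IndepFun (fun ω => fc (s ω) k - ∑ n, B k n * y n ω) (fun ω m => y m ω) P)
    {F : (Fin M → ℝ) → L2} (hF : StronglyMeasurable F) :
    mse P s y F = mse P s y S + ∫⁻ ω, ‖(F fun m => y m ω) - S fun m => y m ω‖ₑ ^ 2 ∂P := by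
  have hym : AEMeasurable (fun ω m => y m ω) P := hy.aestronglyMeasurable.aemeasurable
  have hsm : ∀ k, AEMeasurable (fun ω => fc (s ω) k) P := fun k =>
    (hs k).aestronglyMeasurable.aemeasurable
  have hD : ∫⁻ ω, ‖(F fun m => y m ω) - S fun m => y m ω‖ₑ ^ 2 ∂P =
      ∑' k, ∫⁻ ω, ‖fourierCoeff (F fun m => y m ω) k - fourierCoeff (S fun m => y m ω) k‖ₑ ^ 2
        ∂P := by
    simp only [enorm_sq_eq_tsum, fourierCoeff_L2_sub]
    refine lintegral_tsum fun k => ?_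
    exact (((measurable_fourierCoeff hF k).comp_aemeasurable hym).sub
      ((measurable_fourierCoeff hS k).comp_aemeasurable hym)).enorm.pow_const 2
  rw [mse_eq_tsum hsm hym hF, mse_eq_tsum hsm hym hS, hD, ← ENNReal.tsum_add]
  refine tsum_congr fun k => ?_
  have hR : MemLp (fun ω => fc (s ω) k - ∑ n, B k n * y n ω) 2 P :=
    (hs k).sub (memLp_finsetSum _ fun n _ => MemLp.const_mul (Complex.ofRealCLM.comp_memLp'
      ((ContinuousLinearMap.proj (R := ℝ) (φ := fun _ : Fin M => ℝ) n).comp_memLp' hy)) _)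
  -- Subtracting the `k`-th coefficient of `F(y) - S(y)`, a function of `y`, from the residual of
  -- `S` leaves the residual of `F`.
  have key := lintegral_enorm_sub_sq hR (hR0 k) hym (hind k)
    (g := fun v => fourierCoeff (F v) k - fourierCoeff (S v) k)
    ((measurable_fourierCoeff hF k).sub (measurable_fourierCoeff hS k))
  simp only [hSB] at key ⊢
  simpa only [sub_sub_sub_cancel_right, sub_sub, add_sub_cancel] using key

end Error

/-! ### The data of the estimation problem -/

section Data

variable {Ω : Type*} [MeasurableSpace Ω] {P : Measure Ω}
  {L : LSIOperator} {γ : ℝ} {s : Ω → PerDist} {M : ℕ} {ν : Fin M → PerDist}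
  {x ε : Fin M → Ω → ℝ} {σ : ℝ}

/-- The covariance matrix of the data. -/
def dataCov (h : UnitAddCircle → ℂ) (ν : Fin M → PerDist) (σ : ℝ) :
    Matrix (Fin M) (Fin M) ℂ :=
  gram h ν + ((σ ^ 2 : ℝ) : ℂ) • (1 : Matrix (Fin M) (Fin M) ℂ)

/-- Reading the Gram matrix as a covariance makes its realness and positivity immediate. -/
theorem gram_kernel_apply (hγ : 0 < γ) (hL : L.IsRKHS γ) (hs : IsGaussianBridge P L γ s)
    (hνr : ∀ m, IsRealDist (ν m)) (hν : ∀ m, L.MemDual γ (ν m))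
    (hx : ∀ m, IsMeasurement P s (ν m) (x m)) (m n : Fin M) :
    gram (L.kernel γ) ν m n = ∫ ω, (x m ω : ℂ) * x n ω ∂P :=
  ((hx m).integral_mul hγ hL hs (hν m) (hν n) (hνr n) (hx n)).symm

theorem gram_kernel_im (hγ : 0 < γ) (hL : L.IsRKHS γ) (hs : IsGaussianBridge P L γ s)
    (hνr : ∀ m, IsRealDist (ν m)) (hν : ∀ m, L.MemDual γ (ν m))
    (hx : ∀ m, IsMeasurement P s (ν m) (x m)) (m n : Fin M) :
    (gram (L.kernel γ) ν m n).im = 0 := by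
  rw [gram_kernel_apply hγ hL hs hνr hν hx]
  simp only [← Complex.ofReal_mul]
  rw [integral_complex_ofReal, Complex.ofReal_im]

open scoped ComplexOrder in
-- The matrix `G` is the Gram matrix of the measurements in `L²(P)`, hence positive semidefinite;
-- adding `σ² I` makes it positive definite.
theorem isUnit_det_dataCov (hγ : 0 < γ) (hL : L.IsRKHS γ) (hs : IsGaussianBridge P L γ s)
    (hνr : ∀ m, IsRealDist (ν m)) (hν : ∀ m, L.MemDual γ (ν m))
    (hx : ∀ m, IsMeasurement P s (ν m) (x m)) (hσ : 0 < σ) :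
    IsUnit (dataCov (L.kernel γ) ν σ).det := by
  have hG : gram (L.kernel γ) ν = Matrix.gram ℂ fun m => (hx m).memLp_ofReal.toLp := by
    ext m n
    rw [Matrix.gram_apply, ← integral_mul_conj_eq_inner, gram_kernel_apply hγ hL hs hνr hν hx]
    refine integral_congr_ae (ae_of_all _ fun ω => ?_)
    simp only [Complex.conj_ofReal, mul_comm]
  have hσ2 : (0 : ℂ) < ((σ ^ 2 : ℝ) : ℂ) := by
    rw [← Complex.ofReal_zero, Complex.real_lt_real]
    positivity
  have hpd : (dataCov (L.kernel γ) ν σ).PosDef := by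
    rw [dataCov, hG]
    exact Matrix.PosDef.posSemidef_add (Matrix.posSemidef_gram ℂ _) (Matrix.PosDef.one.smul hσ2)
  exact isUnit_iff_ne_zero.2 hpd.det_pos.ne'

theorem integral_noise_mul
    [IsProbabilityMeasure P] (hε : ∀ m, HasLaw (ε m) (gaussianReal 0 (σ ^ 2).toNNReal) P)
    (hi : iIndepFun ε P) (m n : Fin M) :
    ∫ ω, (ε m ω : ℂ) * ε n ω ∂P = if m = n then ((σ ^ 2 : ℝ) : ℂ) else 0 := by
  have h2 : ∀ m, MemLp (ε m) 2 P := fun m => (hε m).hasGaussianLaw.memLp_two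
  have h0 : ∀ m, ∫ ω, ε m ω ∂P = 0 := fun m => by
    rw [(hε m).integral_eq, integral_id_gaussianReal]
  simp only [← Complex.ofReal_mul]
  rw [integral_complex_ofReal]
  split_ifs with h
  · subst h
    have h3 := (hε m).variance_eq
    rw [variance_id_gaussianReal, variance_eq_sub (h2 m), h0] at h3
    congr 1
    simpa [pow_two, Real.coe_toNNReal _ (mul_self_nonneg σ)] using h3
  · rw [(hi.indepFun h).integral_fun_mul_eq_mul_integral (h2 m).aestronglyMeasurable
      (h2 n).aestronglyMeasurable, h0]
    simp

/-- The correlation of two of the data is the entry of the covariance matrix. -/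
theorem integral_data_mul
    [IsProbabilityMeasure P] (hγ : 0 < γ) (hL : L.IsRKHS γ) (hs : IsGaussianBridge P L γ s)
    (hνr : ∀ m, IsRealDist (ν m)) (hν : ∀ m, L.MemDual γ (ν m))
    (hx : ∀ m, IsMeasurement P s (ν m) (x m))
    (hε : ∀ m, HasLaw (ε m) (gaussianReal 0 (σ ^ 2).toNNReal) P) (hi : iIndepFun ε P)
    (hεs : IndepFun (fun ω (φ : PerTest) => (s ω).1 φ) (fun ω m => ε m ω) P) (m n : Fin M) :
    ∫ ω, ((x m ω + ε m ω : ℝ) : ℂ) * ((x n ω + ε n ω : ℝ) : ℂ) ∂P =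
      dataCov (L.kernel γ) ν σ m n := by
  have hx2 : ∀ m, MemLp (fun ω => (x m ω : ℂ)) 2 P := fun m => (hx m).memLp_ofReal
  have hε2 : ∀ m, MemLp (ε m) 2 P := fun m => (hε m).hasGaussianLaw.memLp_two
  have hε2' : ∀ m, MemLp (fun ω => (ε m ω : ℂ)) 2 P := fun m =>
    Complex.ofRealCLM.comp_memLp' (hε2 m)
  have hxε : ∀ m n, ∫ ω, (x m ω : ℂ) * ε n ω ∂P = 0 := fun m n =>
    (hx m).integral_mul_of_indepFun hγ hs (hε2 n) (hεs.comp measurable_id (measurable_pi_apply n))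
  have h1 : Integrable (fun ω => (x m ω : ℂ) * x n ω) P := (hx2 m).integrable_mul (hx2 n)
  have h2 : Integrable (fun ω => (x m ω : ℂ) * ε n ω) P := (hx2 m).integrable_mul (hε2' n)
  have h3 : Integrable (fun ω => (x n ω : ℂ) * ε m ω) P := (hx2 n).integrable_mul (hε2' m)
  have h4 : Integrable (fun ω => (ε m ω : ℂ) * ε n ω) P := (hε2' m).integrable_mul (hε2' n)
  have h5 : ∀ ω, ((x m ω + ε m ω : ℝ) : ℂ) * ((x n ω + ε n ω : ℝ) : ℂ) =
      ((x m ω : ℂ) * x n ω + x m ω * ε n ω) + ((x n ω : ℂ) * ε m ω + ε m ω * ε n ω) := fun ω => by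
    push_cast
    ring
  have h12 : Integrable (fun ω => (x m ω : ℂ) * x n ω + x m ω * ε n ω) P := h1.add h2
  have h34 : Integrable (fun ω => (x n ω : ℂ) * ε m ω + ε m ω * ε n ω) P := h3.add h4
  simp only [h5]
  rw [integral_add h12 h34, integral_add h1 h2, integral_add h3 h4, hxε, hxε,
    integral_noise_mul hε hi, ← gram_kernel_apply hγ hL hs hνr hν hx, dataCov, Matrix.add_apply,
    Matrix.smul_apply, Matrix.one_apply]
  simp

/-- The coefficients of the best linear estimator of a Fourier coefficient from the data. -/
def regression (L : LSIOperator) (γ : ℝ) (ν : Fin M → PerDist) (σ : ℝ) (k : ℤ) :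
    Fin M → ℂ :=
  Matrix.vecMul (fun m => (L.kernelCoeff γ k : ℂ) * (starRingEnd ℂ) ((ν m).1 (e k)))
    (dataCov (L.kernel γ) ν σ)⁻¹

theorem memLp_data (hx : ∀ m, IsMeasurement P s (ν m) (x m))
    (hε : ∀ m, HasLaw (ε m) (gaussianReal 0 (σ ^ 2).toNNReal) P) (m : Fin M) :
    MemLp (fun ω => x m ω + ε m ω) 2 P :=
  (hx m).1.add (hε m).hasGaussianLaw.memLp_two

theorem integral_residual [IsProbabilityMeasure P] (hγ : 0 < γ) (hs : IsGaussianBridge P L γ s)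
    (hx : ∀ m, IsMeasurement P s (ν m) (x m))
    (hε : ∀ m, HasLaw (ε m) (gaussianReal 0 (σ ^ 2).toNNReal) P) (b : Fin M → ℂ) (k : ℤ) :
    ∫ ω, (fc (s ω) k - ∑ n, b n * ((x n ω + ε n ω : ℝ) : ℂ)) ∂P = 0 := by
  have h1 : ∀ n, Integrable (fun ω => ((x n ω + ε n ω : ℝ) : ℂ)) P := fun n =>
    ((memLp_data hx hε n).integrable (by norm_num)).ofReal
  rw [integral_sub ((hs.memLp_fc hγ k).integrable (by norm_num))
    (integrable_finsetSum _ fun n _ => (h1 n).const_mul _), hs.integral_fc hγ,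
    integral_finsetSum _ fun n _ => (h1 n).const_mul _, zero_sub, neg_eq_zero]
  refine Finset.sum_eq_zero fun n _ => ?_
  have h2 : ∫ ω, ((x n ω + ε n ω : ℝ) : ℂ) ∂P = 0 := by
    have h3 : Integrable (fun ω => (x n ω : ℂ)) P := (hx n).memLp_ofReal.integrable (by norm_num)
    have h4 : Integrable (fun ω => (ε n ω : ℂ)) P :=
      ((hε n).hasGaussianLaw.memLp_two.integrable (by norm_num)).ofReal
    simp only [Complex.ofReal_add]
    rw [integral_add h3 h4, (hx n).integral_eq_zero hγ hs, integral_complex_ofReal,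
      (hε n).integral_eq, integral_id_gaussianReal]
    simp
  rw [integral_const_mul, h2, mul_zero]

/-- These are the normal equations: `regression` is the cross-covariance of `ŝ[k]` and the data
times the inverse of the data covariance. -/
theorem integral_residual_mul
    [IsProbabilityMeasure P] (hγ : 0 < γ) (hL : L.IsRKHS γ) (hs : IsGaussianBridge P L γ s)
    (hνr : ∀ m, IsRealDist (ν m)) (hν : ∀ m, L.MemDual γ (ν m))
    (hx : ∀ m, IsMeasurement P s (ν m) (x m)) (hσ : 0 < σ)
    (hε : ∀ m, HasLaw (ε m) (gaussianReal 0 (σ ^ 2).toNNReal) P) (hi : iIndepFun ε P)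
    (hεs : IndepFun (fun ω (φ : PerTest) => (s ω).1 φ) (fun ω m => ε m ω) P)
    (k : ℤ) (p : Fin M) :
    ∫ ω, (fc (s ω) k - ∑ n, regression L γ ν σ k n * ((x n ω + ε n ω : ℝ) : ℂ)) *
      ((x p ω + ε p ω : ℝ) : ℂ) ∂P = 0 := by
  have hy2 : ∀ m, MemLp (fun ω => ((x m ω + ε m ω : ℝ) : ℂ)) 2 P := fun m =>
    Complex.ofRealCLM.comp_memLp' (memLp_data hx hε m)
  have hV : ∫ ω, fc (s ω) k * ((x p ω + ε p ω : ℝ) : ℂ) ∂P =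
      L.kernelCoeff γ k * (starRingEnd ℂ) ((ν p).1 (e k)) := by
    have h1 : Integrable (fun ω => fc (s ω) k * (x p ω : ℂ)) P :=
      (hs.memLp_fc hγ k).integrable_mul (hx p).memLp_ofReal
    have hε2 : MemLp (fun ω => (ε p ω : ℂ)) 2 P :=
      Complex.ofRealCLM.comp_memLp' (hε p).hasGaussianLaw.memLp_two
    have h2 : Integrable (fun ω => fc (s ω) k * (ε p ω : ℂ)) P :=
      (hs.memLp_fc hγ k).integrable_mul hε2
    have h3 : IndepFun (fun ω => fc (s ω) k) (fun ω => (ε p ω : ℂ)) P :=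
      hεs.comp (φ := fun f : PerTest → ℂ => f (e (-k))) (ψ := fun r : Fin M → ℝ => (r p : ℂ))
        (measurable_pi_apply _) (Complex.measurable_ofReal.comp (measurable_pi_apply p))
    simp only [Complex.ofReal_add, mul_add]
    rw [integral_add h1 h2, (hx p).integral_fc_mul hγ hs,
      h3.integral_fun_mul_eq_mul_integral (hs.memLp_fc hγ k).aestronglyMeasurable
        hε2.aestronglyMeasurable, hs.integral_fc hγ, zero_mul, add_zero]
  have h1 : Integrable (fun ω => fc (s ω) k * ((x p ω + ε p ω : ℝ) : ℂ)) P :=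
    (hs.memLp_fc hγ k).integrable_mul (hy2 p)
  have h2 : ∀ n, Integrable (fun ω => ((x n ω + ε n ω : ℝ) : ℂ) * ((x p ω + ε p ω : ℝ) : ℂ)) P :=
    fun n => (hy2 n).integrable_mul (hy2 p)
  simp only [sub_mul, Finset.sum_mul, mul_assoc]
  rw [integral_sub h1 (integrable_finsetSum _ fun n _ => (h2 n).const_mul _), hV,
    integral_finsetSum _ fun n _ => (h2 n).const_mul _, sub_eq_zero]
  simp only [integral_const_mul, integral_data_mul hγ hL hs hνr hν hx hε hi hεs]
  have hdet := isUnit_det_dataCov (σ := σ) hγ hL hs hνr hν hx hσ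
  have h3 : Matrix.vecMul (regression L γ ν σ k) (dataCov (L.kernel γ) ν σ) =
      fun m => (L.kernelCoeff γ k : ℂ) * (starRingEnd ℂ) ((ν m).1 (e k)) := by
    rw [regression, Matrix.vecMul_vecMul, Matrix.nonsing_inv_mul _ hdet, Matrix.vecMul_one]
  exact (congrFun h3 p).symm

/-- The residuals of the best linear estimators are independent of the data. -/
theorem indepFun_residual
    [IsProbabilityMeasure P] (hγ : 0 < γ) (hL : L.IsRKHS γ) (hs : IsGaussianBridge P L γ s)
    (hνr : ∀ m, IsRealDist (ν m)) (hν : ∀ m, L.MemDual γ (ν m))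
    (hx : ∀ m, IsMeasurement P s (ν m) (x m)) (hσ : 0 < σ)
    (hε : ∀ m, HasLaw (ε m) (gaussianReal 0 (σ ^ 2).toNNReal) P) (hi : iIndepFun ε P)
    (hεs : IndepFun (fun ω (φ : PerTest) => (s ω).1 φ) (fun ω m => ε m ω) P) (k : ℤ) :
    IndepFun (fun ω => fc (s ω) k - ∑ n, regression L γ ν σ k n * ((x n ω + ε n ω : ℝ) : ℂ))
      (fun ω m => x m ω + ε m ω) P := by
  refine indepFun_of_integral_mul_eq_zero ?_ (integral_residual hγ hs hx hε _ k)
    (integral_residual_mul hγ hL hs hνr hν hx hσ hε hi hεs k)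
  have h := hs.hasGaussianLaw_joint hγ hx
    (hi.hasGaussianLaw fun m => (hε m).hasGaussianLaw) hεs k
  -- The data are measurement plus noise and the residual is `ŝ[k] - B y`, so the pair is a linear
  -- image of a jointly Gaussian vector.
  let Y : (ℂ × (Fin M → ℝ)) × (Fin M → ℝ) →L[ℝ] (Fin M → ℝ) :=
    (ContinuousLinearMap.snd ℝ ℂ (Fin M → ℝ)).comp
      (ContinuousLinearMap.fst ℝ (ℂ × (Fin M → ℝ)) (Fin M → ℝ)) +
    ContinuousLinearMap.snd ℝ (ℂ × (Fin M → ℝ)) (Fin M → ℝ)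
  let B : (Fin M → ℝ) →L[ℝ] ℂ := ∑ n,
    (ContinuousLinearMap.mul ℝ ℂ (regression L γ ν σ k n)).comp
      (Complex.ofRealCLM.comp (ContinuousLinearMap.proj n))
  have hB : ∀ v, B v = ∑ n, regression L γ ν σ k n * (v n : ℂ) := fun v => by
    simp only [B, sum_apply]
    rfl
  let A : (ℂ × (Fin M → ℝ)) × (Fin M → ℝ) →L[ℝ] ℂ × (Fin M → ℝ) :=
    ((ContinuousLinearMap.fst ℝ ℂ (Fin M → ℝ)).comp
      (ContinuousLinearMap.fst ℝ (ℂ × (Fin M → ℝ)) (Fin M → ℝ)) - B.comp Y).prod Y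
  refine (h.map A).congr (ae_of_all _ fun ω => Prod.ext ?_ rfl)
  change fc (s ω) k - B (fun m => x m ω + ε m ω) = _
  rw [hB]

end Data

/-- The error of the zero estimator is the trace of the covariance of the process. -/
theorem mse_zero_ne_top {Ω : Type*} [MeasurableSpace Ω] {P : Measure Ω} {L : LSIOperator} {γ : ℝ}
    {s : Ω → PerDist} {M : ℕ} (hγ : 0 < γ) (hL : L.IsRKHS γ)
    (hs : IsGaussianBridge P L γ s) {y : Fin M → Ω → ℝ}
    (hy : AEMeasurable (fun ω m => y m ω) P) : mse P s y (fun _ => 0) ≠ ∞ := by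
  rw [mse_eq_tsum (fun k => (hs.memLp_fc hγ k).aestronglyMeasurable.aemeasurable) hy
    stronglyMeasurable_const]
  have h0 : ∀ k, fourierCoeff (0 : L2) k = 0 := fun k => by
    rw [← fourierBasis_repr, map_zero]
    rfl
  have h1 : ∀ k, ∫⁻ ω, ‖fc (s ω) k - fourierCoeff (0 : L2) k‖ₑ ^ 2 ∂P =
      ENNReal.ofReal (L.kernelCoeff γ k) := by
    intro k
    have h2 := hs.integral_fc_mul_conj hγ k k
    rw [if_pos rfl] at h2
    simp only [Complex.mul_conj, Complex.normSq_eq_norm_sq] at h2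
    rw [integral_complex_ofReal, Complex.ofReal_inj] at h2
    rw [← h2, ofReal_integral_eq_lintegral_ofReal
      ((hs.memLp_fc hγ k).integrable_norm_pow (by norm_num)) (ae_of_all _ fun _ => by positivity)]
    simp only [h0, sub_zero, ← ofReal_norm, ENNReal.ofReal_pow (norm_nonneg _)]
  simp only [h1]
  exact (L.summable_kernelCoeff hγ hL).tsum_ofReal_ne_top

end PeriodicMMSE

end

/-! ### The estimation theorem. -/

open PeriodicMMSE in
theorem theorem2 {Ω : Type*} [MeasurableSpace Ω] (P : Measure Ω) [IsProbabilityMeasure P]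
    (L : LSIOperator) (hL : FiniteDimensional ℂ L.nullSpace)
    (γ₀ : ℝ) (hγ₀ : 0 < γ₀) (hRKHS : L.IsRKHS γ₀)
    (s : Ω → PerDist) (hs : IsGaussianBridge P L γ₀ s)
    (M : ℕ) (ν : Fin M → PerDist) (hνreal : ∀ m, IsRealDist (ν m))
    (hν : ∀ m, L.MemDual γ₀ (ν m))
    (x : Fin M → Ω → ℝ) (hx : ∀ m, IsMeasurement P s (ν m) (x m))
    (σ₀ : ℝ) (hσ₀ : 0 < σ₀)
    (ε : Fin M → Ω → ℝ)
    (hεlaw : ∀ m, HasLaw (ε m) (gaussianReal 0 (σ₀ ^ 2).toNNReal) P)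
    (hεindep : iIndepFun ε P)
    (hεs : IndepFun (fun ω (φ : PerTest) => (s ω).1 φ) (fun ω m => ε m ω) P)
    (y : Fin M → Ω → ℝ) (hy : ∀ m, ∀ᵐ ω ∂P, y m ω = x m ω + ε m ω) :
    let h : UnitAddCircle → ℂ := L.kernel γ₀
    let φ : Fin M → UnitAddCircle → ℂ := fun m => conv h (ν m)
    let G : Matrix (Fin M) (Fin M) ℂ := gram h ν
    let A : Matrix (Fin M) (Fin M) ℂ := G + ((σ₀ ^ 2 : ℝ) : ℂ) • (1 : Matrix (Fin M) (Fin M) ℂ)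
    let d : (Fin M → ℝ) → Fin M → ℂ := fun v => A⁻¹.mulVec fun m => (v m : ℂ)
    -- the series in the formula converge, its ingredients are real, the matrix is invertible
    Summable (L.kernelCoeff γ₀) ∧
    (∀ m t, Summable (bracketTerm (ν m) fun τ => h (t - τ))) ∧
    (∀ m n, Summable (bracketTerm (ν m) (φ n))) ∧
    (∀ m t, (φ m t).im = 0) ∧ (∀ m n, (G m n).im = 0) ∧ IsUnit A.det ∧
    -- the formula gives the minimum mean-square error estimator of the whole process
    ∃ S : (Fin M → ℝ) → L2,
      (∀ v, ∀ᵐ t ∂haar, S v t = ∑ m, d v m * φ m t) ∧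
      IsMMSE P s y S ∧
      ∀ F : (Fin M → ℝ) → L2, IsMMSE P s y F →
        ∀ᵐ ω ∂P, F (fun m => y m ω) = S (fun m => y m ω) := by
  intro h φ G A d
  choose Φ hΦ hΦc using fun m => L.conv_kernel_eq hγ₀ hRKHS (hν m) (hνreal m)
  have hdet : IsUnit A.det := isUnit_det_dataCov hγ₀ hRKHS hs hνreal hν hx hσ₀
  refine ⟨L.summable_kernelCoeff hγ₀ hRKHS,
    fun m t => L.summable_bracketTerm_kernel hγ₀ hRKHS (hν m) t, fun m n => ?_,
    fun m t => L.conv_kernel_im hγ₀ hRKHS (hνreal m) t,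
    fun m n => gram_kernel_im hγ₀ hRKHS hs hνreal hν hx m n, hdet, ?_⟩
  · change Summable (bracketTerm (ν m) (conv (L.kernel γ₀) (ν n)))
    rw [L.bracketTerm_conv_kernel hγ₀ hRKHS (ν m) (hν n) (hνreal n)]
    exact L.summable_kernelCoeff_mul_mul hγ₀ (hν m) (hν n)
  let z : Fin M → Ω → ℝ := fun m ω => x m ω + ε m ω
  have hyz : ∀ᵐ ω ∂P, (fun m => y m ω) = fun m => z m ω := by
    filter_upwards [ae_all_iff.2 hy] with ω hω
    exact funext hω
  have hz2 : MemLp (fun ω m => z m ω) 2 P := MemLp.of_eval fun m => memLp_data hx hεlaw m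
  have hzm : AEMeasurable (fun ω m => z m ω) P := hz2.aestronglyMeasurable.aemeasurable
  let S : (Fin M → ℝ) → L2 := fun v => ∑ m, d v m • ContinuousMap.toLp 2 haar ℂ (Φ m)
  have hS : StronglyMeasurable S := by
    refine Continuous.stronglyMeasurable (continuous_finsetSum _ fun m _ => ?_)
    refine Continuous.smul (f := fun v => d v m) ?_ continuous_const
    have h1 : Continuous fun v : Fin M → ℝ => A⁻¹.mulVec fun n => (v n : ℂ) :=
      Continuous.matrix_mulVec continuous_const
        (by fun_prop)
    exact (continuous_apply m).comp h1
  -- Associativity of `V_kᵀ A⁻¹ v`: applying `A⁻¹` to the data gives `d`, and applying it to the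
  -- vector `V_k` of `k`-th coefficients of the `φ_m` gives the regression row.
  have hSB : ∀ v k, fourierCoeff (S v) k = ∑ n, regression L γ₀ ν σ₀ k n * (v n : ℂ) := by
    intro v k
    have h1 : fourierCoeff (S v) k = ∑ m, d v m * fourierCoeff (Φ m) k := by
      simp only [← fourierCoeff_toLp (Φ _), ← fourierBasis_repr, S, map_sum, map_smul]
      rw [lp.coeFn_sum, Finset.sum_apply]
      rfl
    rw [h1]
    change _ = dotProduct (regression L γ₀ ν σ₀ k) fun n => (v n : ℂ)
    rw [regression, ← Matrix.dotProduct_mulVec, dotProduct]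
    refine Finset.sum_congr rfl fun m _ => ?_
    rw [hΦc, mul_comm]
    rfl
  have hdec : ∀ F : (Fin M → ℝ) → L2, StronglyMeasurable F → mse P s y F =
      mse P s y S + ∫⁻ ω, ‖(F fun m => z m ω) - S fun m => z m ω‖ₑ ^ 2 ∂P := by
    intro F hF
    rw [mse_congr hyz F, mse_congr hyz S]
    exact mse_eq_add (hs.memLp_fc hγ₀) hz2 hS hSB (fun k => integral_residual hγ₀ hs hx hεlaw _ k)
      (indepFun_residual hγ₀ hRKHS hs hνreal hν hx hσ₀ hεlaw hεindep hεs) hF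
  -- The decomposition for the zero estimator bounds the error of `S` by the finite error of zero.
  have hfin : mse P s y S ≠ ∞ := by
    have h0 := mse_zero_ne_top hγ₀ hRKHS hs hzm
    rw [← mse_congr hyz, hdec _ stronglyMeasurable_const] at h0
    exact fun h1 => h0 (by rw [h1, top_add])
  have hmin : ∀ F : (Fin M → ℝ) → L2, StronglyMeasurable F → mse P s y S ≤ mse P s y F :=
    fun F hF => by rw [hdec F hF]; exact le_self_add
  refine ⟨S, fun v => ?_, ⟨hS, hfin, hmin⟩, fun F hF => ?_⟩
  · have h1 : ∀ m, ∀ᵐ t ∂haar, (d v m • ContinuousMap.toLp 2 haar ℂ (Φ m) : L2) t =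
        d v m * φ m t := fun m => by
      filter_upwards [Lp.coeFn_smul (d v m) (ContinuousMap.toLp 2 haar ℂ (Φ m)),
        ContinuousMap.coeFn_toLp (p := 2) (𝕜 := ℂ) haar (Φ m)] with t h2 h3
      rw [h2, Pi.smul_apply, h3, smul_eq_mul]
      change _ = d v m * conv (L.kernel γ₀) (ν m) t
      rw [hΦ]
    filter_upwards [Lp.coeFn_finsetSum Finset.univ fun m =>
      d v m • ContinuousMap.toLp 2 haar ℂ (Φ m), ae_all_iff.2 h1] with t h2 h3
    rw [h2, Finset.sum_apply]
    exact Finset.sum_congr rfl fun m _ => h3 m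
  · have h1 : mse P s y F = mse P s y S := le_antisymm (hF.2.2 S hS) (hmin F hF.1)
    -- Cancelling the common error in `[0, ∞]` requires it to be finite.
    have h2 : ∫⁻ ω, ‖(F fun m => z m ω) - S fun m => z m ω‖ₑ ^ 2 ∂P = 0 := by
      rw [hdec F hF.1] at h1
      exact (ENNReal.add_right_inj hfin).1 (h1.trans (add_zero _).symm)
    have hm : AEMeasurable (fun ω => ‖(F fun m => z m ω) - S fun m => z m ω‖ₑ ^ 2) P :=
      (((hF.1.sub hS).enorm.pow_const 2).comp_aemeasurable hzm)
    filter_upwards [(lintegral_eq_zero_iff' hm).1 h2, hyz] with ω h3 h4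
    rw [h4]
    simpa [sub_eq_zero] using h3
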